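/- **Setting.** Exponents are real, coefficients complex. A formal series $f=\sum_{a\in\mathbb R}c_a x^a$ is *Artinian* (resp. *Noetherian*) if for every $a\in\mathbb R$ there are only finitely many $b\le a$ (resp. $b\ge a$) with $c_b\ne 0$. With coefficientwise addition and the product $\left(\sum_a c_ax^a\right)\left(\sum_b d_bx^b\right)=\sum_e\left(\sum_{a+b=e}c_ad_b\right)x^e$ these series form the Artinian algebra $\mathbb C(x)^{\mathbb R}$ (resp. the Noetherian algebra $\mathbb C(x)_{\mathbb R}$). The degree of a nonzero Artinian (resp. Noetherian) series is the least (resp. greatest) $a$ with $c_a\neq0$. *Topology.* The Artinian (resp. Noetherian) algebra carries the finest topology that makes it a topological group under addition and for which (i) $c_kx^{a_k}\to cx^a$ whenever $c_k\to c$ in $\mathbb C$ and $a_k\to a$ in $\mathbb R$, and (ii) $s_k\to0$ for every sequence of series $s_k$ such that for each $N\in\mathbb R$, for all large $k$, $s_k$ has no nonzero coefficient at an exponent $\le N$ (resp. $\ge N$). *Powers.* For nonzero $z=|z|e^{i\theta}\in\mathbb C$ with $0\le\theta<2\pi$, $t\in\mathbb R$ and $n\in\mathbb Z$ put $z^{t;n}=|z|^te^{it(\theta+2n\pi)}$.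 For a nonzero Artinian (resp. Noetherian) series $g=\sum_a c_ax^a$ of degree $d$ put $$g^{t;n}=c_d^{t;n}\,x^{dt}\sum_M\binom tM\prod_{a\in M}\frac{c_{a+d}}{c_d}x^a,\qquad \binom tM=\frac{t(t-1)\cdots(t-|M|+1)}{\prod_jM(j)!},$$ where $M$ runs over the finite multisets of nonzero real numbers, $M(j)$ is the multiplicity of $j$, $|M|$ is the number of elements of $M$ with multiplicity, and products over $M$ are taken with multiplicity. For $f=\sum_a f_ax^a$ and $g$ of positive degree put $f(g;n)=\sum_a f_a\,g^{a;n}$. Both sums are taken coefficientwise. **Theorem (Characterization of Composition).** Let $g$ be a nonzero Artinian (resp. Noetherian) series of positive degree and let $n$ be an integer. Then every coefficient of the powers $g^{t;n}$ ($t\in\mathbb R$) and of $f(g;n)$ is given by a sum with only finitely many nonzero terms, $f(g;n)$ is again an Artinian (resp. Noetherian) series for every Artinian (resp. Noetherian) series $f$, and $f\mapsto f(g;n)$ is a continuous field automorphism of the Artinian (resp. Noetherian) algebra which fixes all constants $c\in\mathbb C$. Conversely, every continuous field automorphism of the Artinian (resp. Noetherian) algebra which fixes all constants is of the form $f\mapsto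 f(g;n)$ for some nonzero Artinian (resp. Noetherian) series $g$ of positive degree and some integer $n$. -/

import Mathlib

open Filter Topology

noncomputable section

/-- The complex series `∑ c_a x^a` with exponents in an ordered group `Γ`
such that for all `a` only finitely many `b ≤ a` have `c_b ≠ 0`. Such supports are automatically
partially well ordered, so these series live inside `HahnSeries Γ ℂ`, whose addition, (Cauchy)
product and scalar multiplication are the usual ones. -/
def seriesAlgebra (Γ : Type) [AddCommGroup Γ] [LinearOrder Γ] [IsOrderedAddMonoid Γ] :
    Subalgebra ℂ (HahnSeries Γ ℂ) where
  carrier := {f | ∀ a : Γ, {b | b ≤ a ∧ f.coeff b ≠ 0}.Finite}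
  mul_mem' := by
    intro f g hf hg a
    by_cases hf0 : f = 0
    · simp [hf0]
    by_cases hg0 : g = 0
    · simp [hg0]
    refine ((hf (a - g.order)).image2 (· + ·) (hg (a - f.order))).subset ?_
    rintro b ⟨hb, hne⟩
    rw [HahnSeries.coeff_mul] at hne
    obtain ⟨p, hp, -⟩ := Finset.exists_ne_zero_of_sum_ne_zero hne
    rw [Finset.mem_antidiagonal] at hp
    obtain ⟨h1, h2, h3⟩ := hp
    rw [HahnSeries.mem_support] at h1 h2
    have o1 := HahnSeries.order_le_of_coeff_ne_zero h1
    have o2 := HahnSeries.order_le_of_coeff_ne_zero h2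
    refine ⟨p.1, ⟨?_, h1⟩, p.2, ⟨?_, h2⟩, h3⟩
    · rw [le_sub_iff_add_le]
      exact (add_le_add_right o2 p.1).trans (h3.le.trans hb)
    · rw [le_sub_iff_add_le, add_comm]
      exact (add_le_add_left o1 p.2).trans (h3.le.trans hb)
  add_mem' := by
    intro f g hf hg a
    refine ((hf a).union (hg a)).subset ?_
    rintro b ⟨hb, hne⟩
    by_cases h : f.coeff b = 0
    · exact Or.inr ⟨hb, fun h' => hne (by simp [h, h'])⟩
    · exact Or.inl ⟨hb, h⟩
  algebraMap_mem' := by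
    intro c a
    refine (Set.finite_singleton (0 : Γ)).subset ?_
    rintro b ⟨-, hne⟩
    by_contra hb
    apply hne
    rw [HahnSeries.algebraMap_apply]
    exact HahnSeries.coeff_single_of_ne hb

/-- The monomial `c x^a`. -/
def seriesMonomial {Γ : Type} [AddCommGroup Γ] [LinearOrder Γ] [IsOrderedAddMonoid Γ]
    (a : Γ) (c : ℂ) : seriesAlgebra Γ :=
  ⟨HahnSeries.single a c, by
    intro d
    refine (Set.finite_singleton a).subset ?_
    rintro b ⟨-, hne⟩
    by_contra hb
    exact hne (HahnSeries.coeff_single_of_ne hb)⟩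

/-- The requirements on a topology on the algebra of series: it is an additive group topology,
`c_n x^{a_n} → c x^a` whenever `c_n → c` and `a_n → a`, and `s_n → 0` whenever the
lowest exponents of the `s_n` increase without bound in `Γ`. The last condition covers the
monomials `c_n x^{a_n}` with `a_n` unbounded as well as the remainders of a series after its
partial sums (so that each series is the limit of its partial sums). -/
structure IsSeriesTopology (Γ : Type) [AddCommGroup Γ] [LinearOrder Γ] [IsOrderedAddMonoid Γ]
    [TopologicalSpace Γ] (τ : TopologicalSpace (seriesAlgebra Γ)) : Prop where
  group : @IsTopologicalAddGroup (seriesAlgebra Γ) τ _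
  monomial : ∀ (a : ℕ → Γ) (c : ℕ → ℂ) (α : Γ) (γ : ℂ),
    Tendsto a atTop (𝓝 α) → Tendsto c atTop (𝓝 γ) →
      Tendsto (fun k => seriesMonomial (a k) (c k)) atTop
        (@nhds (seriesAlgebra Γ) τ (seriesMonomial α γ))
  tail : ∀ s : ℕ → seriesAlgebra Γ,
    (∀ N : Γ, ∀ᶠ k in atTop, ∀ a ≤ N, (s k).1.coeff a = 0) →
      Tendsto s atTop (@nhds (seriesAlgebra Γ) τ 0)

/-- The finest topology satisfying `IsSeriesTopology` (in Mathlib's order on topologies finer means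
smaller, and an infimum of topologies satisfying the requirements satisfies them). -/
@[reducible]
def seriesTopology (Γ : Type) [AddCommGroup Γ] [LinearOrder Γ] [IsOrderedAddMonoid Γ]
    [TopologicalSpace Γ] : TopologicalSpace (seriesAlgebra Γ) :=
  sInf {τ | IsSeriesTopology Γ τ}

/-- The infimum of the topologies satisfying the requirements satisfies them. -/
theorem isSeriesTopology_seriesTopology (Γ : Type) [AddCommGroup Γ] [LinearOrder Γ]
    [IsOrderedAddMonoid Γ] [TopologicalSpace Γ] : IsSeriesTopology Γ (seriesTopology Γ) where
  group := topologicalAddGroup_sInf fun _ h => h.group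
  monomial := by
    intro a c α γ ha hc
    rw [seriesTopology, nhds_sInf]
    simp only [tendsto_iInf]
    exact fun τ hτ => hτ.monomial a c α γ ha hc
  tail := by
    intro s hs
    rw [seriesTopology, nhds_sInf]
    simp only [tendsto_iInf]
    exact fun τ hτ => hτ.tail s hs

/-- The Artinian algebra `ℂ(x)^ℝ`: for all `a`, only finitely many `b ≤ a` have `c_b ≠ 0`. -/
abbrev ArtinianAlgebra : Type := seriesAlgebra ℝ

/-- The Noetherian algebra `ℂ(x)_ℝ`: for all `a`, only finitely many `b ≥ a` have `c_b ≠ 0`. -/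
abbrev NoetherianAlgebra : Type := seriesAlgebra ℝᵒᵈ

/-- The coefficients `[x^a] f` of an Artinian series. -/
def artinianCoeff (f : ArtinianAlgebra) (a : ℝ) : ℂ := f.1.coeff a

/-- The coefficients `[x^a] f` of a Noetherian series. -/
def noetherianCoeff (f : NoetherianAlgebra) (a : ℝ) : ℂ := f.1.coeff (OrderDual.toDual a)

/-- `f` is nonzero and its degree (lowest exponent) is `d`. -/
def ArtinianHasDegree (f : ArtinianAlgebra) (d : ℝ) : Prop :=
  IsLeast {a | artinianCoeff f a ≠ 0} d

/-- `f` is nonzero and its degree (highest exponent) is `d`. -/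
def NoetherianHasDegree (f : NoetherianAlgebra) (d : ℝ) : Prop :=
  IsGreatest {a | noetherianCoeff f a ≠ 0} d

/-- The topology of the Artinian algebra. -/
@[reducible]
def artinianTopology : TopologicalSpace ArtinianAlgebra := seriesTopology ℝ

/-- The topology of the Noetherian algebra. -/
@[reducible]
def noetherianTopology : TopologicalSpace NoetherianAlgebra := seriesTopology ℝᵒᵈ

/-- The argument of `z`, taken in `[0, 2π)` (and `0` for `z = 0`). -/
def argNonneg (z : ℂ) : ℝ := toIcoMod Real.two_pi_pos 0 z.arg

/-- The `n`-th value `z^{t;n} = |z|^t e^{it(θ + 2nπ)}`, where `θ ∈ [0, 2π)` is the argument of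
the nonzero complex number `z`. -/
def complexPow (z : ℂ) (t : ℝ) (n : ℤ) : ℂ :=
  ((‖z‖ ^ t : ℝ) : ℂ) *
    Complex.exp (Complex.I * ((t * (argNonneg z + 2 * (n : ℝ) * Real.pi) : ℝ) : ℂ))

/-- The multinomial coefficient `t(t-1)⋯(t-|M|+1) / ∏_j M(j)!`. -/
def multinomialCoeff (t : ℝ) (M : Multiset ℝ) : ℝ :=
  (∏ i ∈ Finset.range (Multiset.card M), (t - (i : ℝ))) /
    ∏ j ∈ M.toFinset, ((M.count j).factorial : ℝ)

/-- The coefficient of the summand of `g^{t;n}` that belongs to the multiset `M`. -/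
def powTerm (g : ℝ → ℂ) (d t : ℝ) (M : Multiset ℝ) : ℂ :=
  (multinomialCoeff t M : ℂ) * (M.map fun a => g (a + d) / g d).prod

/-- The finite multisets of nonzero reals whose summand in `g^{t;n}` is a multiple of `x^b`. -/
def powIndex (d t b : ℝ) : Set (Multiset ℝ) := {M | 0 ∉ M ∧ d * t + M.sum = b}

/-- The coefficient of `x^b` in
`g^{t;n} = g_d^{t;n} x^{dt} ∑_M (t choose M) ∏_{a ∈ M} (g_{a+d} / g_d) x^a`,
where `g` is given by its coefficients and has degree `d`. -/
def powCoeff (g : ℝ → ℂ) (d t : ℝ) (n : ℤ) (b : ℝ) : ℂ :=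
  complexPow (g d) t n * ∑ᶠ M ∈ powIndex d t b, powTerm g d t M

/-- `h = f(g;n) = ∑_a f_a g^{a;n}`, for series given by their coefficients with `g` of degree `d`;
included is that the sums defining the coefficients of the powers `g^{t;n}` and of `f(g;n)`
have only finitely many nonzero terms. -/
structure IsComposition (f g : ℝ → ℂ) (d : ℝ) (n : ℤ) (h : ℝ → ℂ) : Prop where
  pow_finite : ∀ t b : ℝ, (powIndex d t b ∩ Function.support (powTerm g d t)).Finite
  finite : ∀ b : ℝ, (Function.support fun a => f a * powCoeff g d a n b).Finite
  coeff_eq : ∀ b : ℝ, h b = ∑ᶠ a : ℝ, f a * powCoeff g d a n b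

end

/-! Write `g = g_d x^d (1 + y)` with `y` of positive degree. Then `g^{t;n}` is the monomial
`g_d^{t;n} x^{dt}` times the binomial series `(1 + y)^t`. The multinomial theorem identifies its
coefficients with the sums over multisets, and Vandermonde's identity makes `t ↦ g^{t;n}` a
one-parameter group (`powCoeff_eq`, `powSeries_add`). Substitution extends `x^a ↦ g^{a;n}` linearly.
It is multiplicative on monomials, hence everywhere by truncation. Since `x^a` goes to a nonzero
multiple of `x^{da}` plus terms at least a fixed `δ` higher, the map is triangular for the
filtration by exponents: lowest terms give injectivity, and successive approximation gains `δ` per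
step and gives surjectivity. The topology being the finest one, continuity has to be tested only on
the two kinds of sequences that define it. Conversely, a continuous `σ` yields a continuous
one-parameter group `H(a) = σ(x^a)`; put `g = H(1)`. At a rational `q`, `H(q)` and `g^{q;0}` differ
by a root of unity in the field, which is a constant. Density of the rationals, compactness of the
circle and the Hausdorff property give `H(a) = χ(a) g^{a;0}` with a continuous character `χ` of `ℝ`
and `χ(1) = 1`. Hence `χ(a) = e^{2πina}`, which turns the branch `0` into the branch `n`
(`exists_eq_powSeries_of_tendsto`). The degree of `g` is positive because `c_k x^k → 0` for all
scalars `c_k`. Finally `σ` and the substitution agree on finite sums of monomials, which are dense.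
The Noetherian case follows by `x ↦ x⁻¹`. This negates degrees and exponents, so the Artinian
argument is carried out for `x^a ↦ g^{εa;n}` with `ε = ±1` and `εd > 0`. -/

noncomputable section

instance seriesSub (Γ : Type) [AddCommGroup Γ] [LinearOrder Γ] [IsOrderedAddMonoid Γ] :
    Sub (seriesAlgebra Γ) :=
  SubNegMonoid.toSub (self := AddGroup.toSubNegMonoid (self := AddCommGroup.toAddGroup
    (self := Ring.toAddCommGroup (self := (seriesAlgebra Γ).toRing))))

/-! ### Filtration by exponents, monomials and truncation -/

/-- The series all of whose exponents are at least `N`. -/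
def seriesGE (N : ℝ) : Submodule ℂ ArtinianAlgebra where
  carrier := {f | ∀ b < N, f.1.coeff b = 0}
  add_mem' := by
    intro f g hf hg b hb
    simp [hf b hb, hg b hb]
  zero_mem' := by
    intro b _
    simp
  smul_mem' := by
    intro c f hf b hb
    simp [hf b hb]

theorem mem_seriesGE {N : ℝ} {f : ArtinianAlgebra} :
    f ∈ seriesGE N ↔ ∀ b < N, f.1.coeff b = 0 := Iff.rfl

theorem seriesGE_anti {M N : ℝ} (h : M ≤ N) {f : ArtinianAlgebra} (hf : f ∈ seriesGE N) :
    f ∈ seriesGE M := fun b hb => hf b (hb.trans_le h)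

theorem series_ext {f g : ArtinianAlgebra} (h : ∀ b, f.1.coeff b = g.1.coeff b) : f = g :=
  Subtype.ext (HahnSeries.ext (funext h))

theorem coeff_sub (f g : ArtinianAlgebra) (b : ℝ) :
    (f - g).1.coeff b = f.1.coeff b - g.1.coeff b := rfl

theorem coeff_add (f g : ArtinianAlgebra) (b : ℝ) :
    (f + g).1.coeff b = f.1.coeff b + g.1.coeff b := rfl

theorem coeff_smul (c : ℂ) (f : ArtinianAlgebra) (b : ℝ) :
    (c • f).1.coeff b = c * f.1.coeff b := rfl

theorem sub_mem_seriesGE {N : ℝ} {f g : ArtinianAlgebra} (hf : f ∈ seriesGE N)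
    (hg : g ∈ seriesGE N) : f - g ∈ seriesGE N := by
  intro b hb
  rw [coeff_sub, hf b hb, hg b hb, sub_zero]

theorem exists_isLeast_support {f : ArtinianAlgebra} (hf : f ≠ 0) :
    ∃ N, f ∈ seriesGE N ∧ f.1.coeff N ≠ 0 := by
  have h0 : f.1 ≠ 0 := fun h => hf (Subtype.ext h)
  exact ⟨f.1.order, fun b hb => HahnSeries.coeff_eq_zero_of_lt_order hb,
    HahnSeries.coeff_order_eq_zero.not.2 h0⟩

theorem exists_mem_seriesGE (f : ArtinianAlgebra) : ∃ N, f ∈ seriesGE N := by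
  by_cases hf : f = 0
  · exact ⟨0, hf ▸ Submodule.zero_mem _⟩
  · obtain ⟨N, h, -⟩ := exists_isLeast_support hf
    exact ⟨N, h⟩

theorem mul_mem_seriesGE {M N : ℝ} {f g : ArtinianAlgebra} (hf : f ∈ seriesGE M)
    (hg : g ∈ seriesGE N) : f * g ∈ seriesGE (M + N) := by
  intro b hb
  rw [MulMemClass.coe_mul, HahnSeries.coeff_mul]
  refine Finset.sum_eq_zero fun p hp => ?_
  rw [Finset.mem_antidiagonal] at hp
  obtain ⟨-, -, h3⟩ := hp
  by_cases h : p.1 < M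
  · rw [hf _ h, zero_mul]
  · rw [hg _ (by linarith), mul_zero]

theorem pow_mem_seriesGE {M : ℝ} {f : ArtinianAlgebra} (hf : f ∈ seriesGE M) (k : ℕ) :
    f ^ k ∈ seriesGE (k * M) := by
  induction k with
  | zero =>
    intro b hb
    rw [pow_zero, OneMemClass.coe_one, HahnSeries.coeff_one, if_neg]
    rintro rfl
    simp at hb
  | succ k ih =>
    rw [pow_succ]
    convert mul_mem_seriesGE ih hf using 2
    push_cast
    ring

theorem eq_of_forall_sub_mem_seriesGE {f g : ArtinianAlgebra} (h : ∀ N, f - g ∈ seriesGE N) :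
    f = g := by
  refine series_ext fun b => ?_
  have := h (b + 1) b (by linarith)
  rwa [coeff_sub, sub_eq_zero] at this

theorem coeff_seriesMonomial (a b : ℝ) (c : ℂ) :
    (seriesMonomial a c).1.coeff b = if b = a then c else 0 := by
  simp [seriesMonomial, HahnSeries.coeff_single]

theorem seriesMonomial_mem_seriesGE (a : ℝ) (c : ℂ) : seriesMonomial a c ∈ seriesGE a := by
  intro b hb
  rw [coeff_seriesMonomial, if_neg hb.ne]

theorem seriesMonomial_mul (a b : ℝ) (c d : ℂ) :
    seriesMonomial a c * seriesMonomial b d = seriesMonomial (a + b) (c * d) :=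
  Subtype.ext (by simp [seriesMonomial])

theorem seriesMonomial_zero_one : seriesMonomial (0 : ℝ) 1 = 1 :=
  Subtype.ext (by simp [seriesMonomial])

theorem seriesMonomial_pow (a : ℝ) (k : ℕ) :
    seriesMonomial a 1 ^ k = seriesMonomial (k * a) 1 := by
  induction k with
  | zero => simp [seriesMonomial_zero_one]
  | succ k ih =>
    rw [pow_succ, ih, seriesMonomial_mul]
    congr 1
    · push_cast
      ring
    · simp

theorem seriesMonomial_eq_smul (a : ℝ) (c : ℂ) :
    seriesMonomial a c = c • seriesMonomial a 1 := by
  refine series_ext fun b => ?_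
  rw [coeff_smul, coeff_seriesMonomial, coeff_seriesMonomial]
  simp

theorem coeff_monomial_mul (a b : ℝ) (c : ℂ) (f : ArtinianAlgebra) :
    (seriesMonomial a c * f).1.coeff b = c * f.1.coeff (b - a) := by
  rw [MulMemClass.coe_mul]
  exact HahnSeries.coeff_single_mul

theorem coeff_sum {ι : Type*} (s : Finset ι) (f : ι → ArtinianAlgebra) (b : ℝ) :
    (∑ i ∈ s, f i).1.coeff b = ∑ i ∈ s, (f i).1.coeff b := by
  rw [AddSubmonoidClass.coe_finsetSum, HahnSeries.coeff_sum]

/-- The series with given coefficients. -/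
def seriesOfCoeff (c : ℝ → ℂ) (hc : ∀ a, {b | b ≤ a ∧ c b ≠ 0}.Finite) : ArtinianAlgebra :=
  ⟨⟨c, by
    refine Set.IsWF.isPWO ?_
    rw [Set.isWF_iff_no_descending_seq]
    intro u hu hmem
    refine Set.infinite_of_injective_forall_mem (s := {b | b ≤ u 0 ∧ c b ≠ 0}) hu.injective
      (fun k => ⟨hu.antitone (Nat.zero_le k), hmem k⟩) (hc (u 0))⟩, hc⟩

theorem coeff_seriesOfCoeff (c : ℝ → ℂ) (hc) (b : ℝ) : (seriesOfCoeff c hc).1.coeff b = c b := rfl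

/-- The finite set of the exponents of `f` that are at most `N`. -/
def exponentsLE (f : ArtinianAlgebra) (N : ℝ) : Finset ℝ := (f.2 N).toFinset

theorem mem_exponentsLE {f : ArtinianAlgebra} {N a : ℝ} :
    a ∈ exponentsLE f N ↔ a ≤ N ∧ f.1.coeff a ≠ 0 := by
  simp [exponentsLE]

/-- The sum of the terms of `f` with exponent at most `N`. -/
def truncLE (f : ArtinianAlgebra) (N : ℝ) : ArtinianAlgebra :=
  ∑ a ∈ exponentsLE f N, seriesMonomial a (f.1.coeff a)

theorem coeff_truncLE (f : ArtinianAlgebra) (N b : ℝ) :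
    (truncLE f N).1.coeff b = if b ≤ N then f.1.coeff b else 0 := by
  rw [truncLE, coeff_sum]
  simp only [coeff_seriesMonomial, Finset.sum_ite_eq, mem_exponentsLE]
  by_cases h : f.1.coeff b = 0 <;> simp [h]

theorem sub_truncLE_mem (f : ArtinianAlgebra) (N : ℝ) : f - truncLE f N ∈ seriesGE N := by
  intro b hb
  rw [coeff_sub, coeff_truncLE, if_pos hb.le, sub_self]

/-- Up to a remainder of high exponent every series is a finite sum of monomials, and both maps send
such remainders to high exponents. -/
theorem linearMap_ext_of_monomial {φ ψ : ArtinianAlgebra →ₗ[ℂ] ArtinianAlgebra}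
    (hφ : ∀ N, ∃ M, ∀ f ∈ seriesGE M, φ f ∈ seriesGE N)
    (hψ : ∀ N, ∃ M, ∀ f ∈ seriesGE M, ψ f ∈ seriesGE N)
    (h : ∀ a c, φ (seriesMonomial a c) = ψ (seriesMonomial a c)) (f : ArtinianAlgebra) :
    φ f = ψ f := by
  refine eq_of_forall_sub_mem_seriesGE fun N => ?_
  obtain ⟨M₁, h₁⟩ := hφ N
  obtain ⟨M₂, h₂⟩ := hψ N
  have e := sub_truncLE_mem f (max M₁ M₂)
  have e₁ := h₁ _ (seriesGE_anti (le_max_left _ _) e)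
  have e₂ := h₂ _ (seriesGE_anti (le_max_right _ _) e)
  have e₃ : φ (truncLE f (max M₁ M₂)) = ψ (truncLE f (max M₁ M₂)) := by
    simp only [truncLE, map_sum, h]
  rw [map_sub φ] at e₁
  rw [map_sub ψ] at e₂
  have := sub_mem_seriesGE e₁ e₂
  rwa [e₃, sub_sub_sub_cancel_right] at this

/-- Completeness for the filtration: only finitely many `F k` contribute to a given coefficient. -/
theorem exists_limit_of_seriesGE (F : ℕ → ArtinianAlgebra) (N : ℕ → ℝ) (hN : Monotone N)
    (hN' : Tendsto N atTop atTop) (hF : ∀ k, F k ∈ seriesGE (N k)) :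
    ∃ f : ArtinianAlgebra, ∀ K, f - ∑ k ∈ Finset.range K, F k ∈ seriesGE (N K) := by
  have key : ∀ b K, b < N K →
      ∑ᶠ k, (F k).1.coeff b = ∑ k ∈ Finset.range K, (F k).1.coeff b := by
    intro b K hb
    refine finsum_eq_sum_of_support_subset _ fun k hk => ?_
    rw [Finset.coe_range, Set.mem_Iio]
    by_contra hk'
    exact hk (hF k b (hb.trans_le (hN (not_lt.1 hk'))))
  refine ⟨seriesOfCoeff (fun b => ∑ᶠ k, (F k).1.coeff b) fun a => ?_, fun K b hb => ?_⟩
  · obtain ⟨K, hK⟩ := (hN'.eventually_gt_atTop a).exists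
    refine ((∑ k ∈ Finset.range K, F k).2 a).subset ?_
    rintro b ⟨hb, hne⟩
    rw [key b K (hb.trans_lt hK)] at hne
    exact ⟨hb, by rwa [coeff_sum]⟩
  · rw [coeff_sub, coeff_sum, coeff_seriesOfCoeff,
      key b K hb, sub_self]

/-! ### Power series evaluated at a series of positive degree -/

theorem exists_pos_mem_seriesGE {y : ArtinianAlgebra} (hy : y ∈ seriesGE 0)
    (hy0 : y.1.coeff 0 = 0) : ∃ δ > 0, y ∈ seriesGE δ := by
  by_cases h : y = 0
  · exact ⟨1, one_pos, h ▸ Submodule.zero_mem _⟩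
  obtain ⟨N, h1, h2⟩ := exists_isLeast_support h
  refine ⟨N, lt_of_le_of_ne (not_lt.1 fun hN => h2 (hy N hN)) ?_, h1⟩
  rintro rfl
  exact h2 hy0

theorem orderTop_pos_of_mem_seriesGE {δ : ℝ} (hδ : 0 < δ) {y : ArtinianAlgebra}
    (hy : y ∈ seriesGE δ) : 0 < y.1.orderTop := by
  by_cases h : y.1 = 0
  · simp [h]
  · rw [HahnSeries.zero_lt_orderTop_iff h]
    by_contra h'
    exact HahnSeries.coeff_order_eq_zero.not.2 h (hy _ ((not_lt.1 h').trans_lt hδ))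

/-- The power `y ^ k` starts at `k * δ` or later, so the terms with `k ≥ K` do not reach the
exponent `b`. -/
theorem coeff_heval_eq_sum {δ : ℝ} (hδ : 0 < δ) {y : ArtinianAlgebra} (hy : y ∈ seriesGE δ)
    (f : PowerSeries ℂ) (K : ℕ) {b : ℝ} (hb : b < K * δ) :
    (PowerSeries.heval y.1 f).coeff b
      = ∑ k ∈ Finset.range K, f.coeff k * (y ^ k).1.coeff b := by
  rw [PowerSeries.coeff_heval]
  have h (k : ℕ) : (HahnSeries.SummableFamily.powerSeriesFamily y.1 f).coeff b k
      = f.coeff k * (y ^ k).1.coeff b := by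
    rw [HahnSeries.SummableFamily.coeff_apply,
      HahnSeries.SummableFamily.powerSeriesFamily_of_orderTop_pos
        (orderTop_pos_of_mem_seriesGE hδ hy), HahnSeries.coeff_smul, smul_eq_mul,
      SubmonoidClass.coe_pow]
  simp only [h]
  refine finsum_eq_sum_of_support_subset _ fun k hk => ?_
  rw [Finset.coe_range, Set.mem_Iio]
  by_contra hk'
  refine hk (mul_eq_zero_of_right _ (pow_mem_seriesGE hy k b (hb.trans_le ?_)))
  have : (K : ℝ) ≤ k := by exact_mod_cast not_lt.1 hk'
  gcongr

theorem heval_mem_seriesAlgebra {δ : ℝ} (hδ : 0 < δ) {y : ArtinianAlgebra}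
    (hy : y ∈ seriesGE δ) (f : PowerSeries ℂ) : PowerSeries.heval y.1 f ∈ seriesAlgebra ℝ := by
  intro a
  obtain ⟨K, hK⟩ := exists_nat_gt (a / δ)
  rw [div_lt_iff₀ hδ] at hK
  refine ((∑ k ∈ Finset.range K, f.coeff k • y ^ k : ArtinianAlgebra).2 a).subset ?_
  rintro b ⟨hb, hne⟩
  rw [coeff_heval_eq_sum hδ hy f K (hb.trans_lt hK)] at hne
  refine ⟨hb, ?_⟩
  rw [coeff_sum]
  exact hne

open Classical in
/-- The value of a power series at the series `y` of positive degree. -/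
def hevalSeries (y : ArtinianAlgebra) (f : PowerSeries ℂ) : ArtinianAlgebra :=
  -- The value `0` is only a default; by `heval_mem_seriesAlgebra` it is never taken when `y` has
  -- positive degree.
  if h : PowerSeries.heval y.1 f ∈ seriesAlgebra ℝ then ⟨_, h⟩ else 0

theorem coe_hevalSeries {δ : ℝ} (hδ : 0 < δ) {y : ArtinianAlgebra} (hy : y ∈ seriesGE δ)
    (f : PowerSeries ℂ) : (hevalSeries y f).1 = PowerSeries.heval y.1 f := by
  rw [hevalSeries, dif_pos (heval_mem_seriesAlgebra hδ hy f)]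

theorem hevalSeries_mul {δ : ℝ} (hδ : 0 < δ) {y : ArtinianAlgebra} (hy : y ∈ seriesGE δ)
    (f g : PowerSeries ℂ) : hevalSeries y (f * g) = hevalSeries y f * hevalSeries y g := by
  apply Subtype.ext
  rw [MulMemClass.coe_mul]
  simp only [coe_hevalSeries hδ hy, map_mul]

theorem hevalSeries_one {δ : ℝ} (hδ : 0 < δ) {y : ArtinianAlgebra} (hy : y ∈ seriesGE δ) :
    hevalSeries y 1 = 1 := by
  apply Subtype.ext
  rw [coe_hevalSeries hδ hy, map_one, OneMemClass.coe_one]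

theorem hevalSeries_one_add_X {δ : ℝ} (hδ : 0 < δ) {y : ArtinianAlgebra}
    (hy : y ∈ seriesGE δ) : hevalSeries y (1 + PowerSeries.X) = 1 + y := by
  apply Subtype.ext
  rw [coe_hevalSeries hδ hy, map_add, map_one,
    PowerSeries.heval_X _ (orderTop_pos_of_mem_seriesGE hδ hy)]
  rfl

theorem coeff_hevalSeries {δ : ℝ} (hδ : 0 < δ) {y : ArtinianAlgebra} (hy : y ∈ seriesGE δ)
    (f : PowerSeries ℂ) (K : ℕ) {b : ℝ} (hb : b < K * δ) :
    (hevalSeries y f).1.coeff b = ∑ k ∈ Finset.range K, f.coeff k * (y ^ k).1.coeff b := by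
  rw [coe_hevalSeries hδ hy, coeff_heval_eq_sum hδ hy f K hb]

theorem hevalSeries_sub_sum_mem {δ : ℝ} (hδ : 0 < δ) {y : ArtinianAlgebra}
    (hy : y ∈ seriesGE δ) (f : PowerSeries ℂ) (K : ℕ) :
    hevalSeries y f - ∑ k ∈ Finset.range K, f.coeff k • y ^ k ∈ seriesGE (K * δ) := by
  intro b hb
  rw [coeff_sub, coeff_hevalSeries hδ hy f K hb, coeff_sum]
  exact sub_self _

/-! ### The powers of a series as a one-parameter group -/

theorem artinianHasDegree_iff {g : ArtinianAlgebra} {e : ℝ} :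
    ArtinianHasDegree g e ↔ g.1.coeff e ≠ 0 ∧ g ∈ seriesGE e := by
  refine and_congr Iff.rfl ⟨fun h b hb => ?_, fun h b hb => ?_⟩
  · by_contra hne
    exact hb.not_ge (h hne)
  · by_contra hlt
    exact hb (h b (not_le.1 hlt))

/-- The series `y` with `g = g_e x^e (1 + y)`. -/
def unitPart (g : ArtinianAlgebra) (e : ℝ) : ArtinianAlgebra :=
  seriesMonomial (-e) (g.1.coeff e)⁻¹ * g - 1

theorem coeff_unitPart (g : ArtinianAlgebra) (e a : ℝ) :
    (unitPart g e).1.coeff a = g.1.coeff (a + e) / g.1.coeff e - if a = 0 then 1 else 0 := by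
  rw [unitPart, coeff_sub, coeff_monomial_mul, OneMemClass.coe_one, HahnSeries.coeff_one,
    sub_neg_eq_add]
  ring

theorem unitPart_coeff_zero {g : ArtinianAlgebra} {e : ℝ} (hg : ArtinianHasDegree g e) :
    (unitPart g e).1.coeff 0 = 0 := by
  rw [artinianHasDegree_iff] at hg
  rw [coeff_unitPart, zero_add, div_self hg.1, if_pos rfl, sub_self]

theorem exists_unitPart_mem {g : ArtinianAlgebra} {e : ℝ} (hg : ArtinianHasDegree g e) :
    ∃ δ > 0, unitPart g e ∈ seriesGE δ := by
  refine exists_pos_mem_seriesGE (fun b hb => ?_) (unitPart_coeff_zero hg)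
  rw [artinianHasDegree_iff] at hg
  rw [coeff_unitPart, hg.2 _ (by linarith), if_neg hb.ne, zero_div, sub_self]

theorem monomial_mul_one_add_unitPart {g : ArtinianAlgebra} {e : ℝ}
    (hg : ArtinianHasDegree g e) :
    seriesMonomial e (g.1.coeff e) * (1 + unitPart g e) = g := by
  rw [artinianHasDegree_iff] at hg
  have : 1 + unitPart g e = seriesMonomial (-e) (g.1.coeff e)⁻¹ * g := by
    rw [unitPart]
    abel
  rw [this, ← mul_assoc, seriesMonomial_mul, add_neg_cancel, mul_inv_cancel₀ hg.1,
    seriesMonomial_zero_one, one_mul]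

theorem complexPow_zero (z : ℂ) (n : ℤ) : complexPow z 0 n = 1 := by
  simp [complexPow]

theorem complexPow_add {z : ℂ} (hz : z ≠ 0) (s t : ℝ) (n : ℤ) :
    complexPow z (s + t) n = complexPow z s n * complexPow z t n := by
  rw [complexPow, complexPow, complexPow, Real.rpow_add (norm_pos_iff.2 hz), mul_mul_mul_comm,
    ← Complex.exp_add]
  push_cast
  ring_nf

theorem complexPow_ne_zero {z : ℂ} (hz : z ≠ 0) (t : ℝ) (n : ℤ) : complexPow z t n ≠ 0 := by
  refine mul_ne_zero ?_ (Complex.exp_ne_zero _)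
  exact_mod_cast (Real.rpow_pos_of_pos (norm_pos_iff.2 hz) t).ne'

theorem complexPow_one {z : ℂ} (n : ℤ) : complexPow z 1 n = z := by
  -- The argument in `[0, 2π)` and the principal argument differ by a multiple of `2π`, invisible
  -- when the exponent is `1`.
  have h : ∃ m : ℤ, argNonneg z + 2 * (n : ℝ) * Real.pi = z.arg + m * (2 * Real.pi) := by
    refine ⟨n - toIcoDiv Real.two_pi_pos 0 z.arg, ?_⟩
    rw [argNonneg, toIcoMod]
    push_cast
    rw [zsmul_eq_mul]
    ring
  obtain ⟨m, hm⟩ := h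
  rw [complexPow, Real.rpow_one, one_mul, hm]
  push_cast
  rw [mul_add, Complex.exp_add,
    show Complex.I * (m * (2 * Real.pi)) = m * (2 * Real.pi * Complex.I) by ring,
    Complex.exp_int_mul_two_pi_mul_I, mul_one, mul_comm Complex.I, Complex.norm_mul_exp_arg_mul_I]

theorem complexPow_eq_mul_exp (z : ℂ) (t : ℝ) (n : ℤ) :
    complexPow z t n
      = complexPow z t 0 * Complex.exp (Complex.I * ((t * (2 * n * Real.pi) : ℝ) : ℂ)) := by
  rw [complexPow, complexPow, mul_assoc ((‖z‖ ^ t : ℝ) : ℂ), ← Complex.exp_add]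
  push_cast
  ring_nf

theorem continuous_complexPow {z : ℂ} (hz : z ≠ 0) (n : ℤ) :
    Continuous fun t => complexPow z t n := by
  unfold complexPow
  have : Continuous fun t : ℝ => ‖z‖ ^ t := Real.continuous_const_rpow (norm_ne_zero_iff.2 hz)
  fun_prop

/-- The power `g^{t;n}` of a series `g` of degree `e`. -/
def powSeries (g : ArtinianAlgebra) (e t : ℝ) (n : ℤ) : ArtinianAlgebra :=
  seriesMonomial (e * t) (complexPow (g.1.coeff e) t n) *
    hevalSeries (unitPart g e) (PowerSeries.binomialSeries ℂ t)

theorem powSeries_add {g : ArtinianAlgebra} {e : ℝ} (hg : ArtinianHasDegree g e) (s t : ℝ)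
    (n : ℤ) : powSeries g e (s + t) n = powSeries g e s n * powSeries g e t n := by
  obtain ⟨δ, hδ, hy⟩ := exists_unitPart_mem hg
  rw [powSeries, powSeries, powSeries, PowerSeries.binomialSeries_add, hevalSeries_mul hδ hy,
    mul_mul_mul_comm, seriesMonomial_mul, mul_add, complexPow_add (artinianHasDegree_iff.1 hg).1]

theorem powSeries_zero {g : ArtinianAlgebra} {e : ℝ} (hg : ArtinianHasDegree g e) (n : ℤ) :
    powSeries g e 0 n = 1 := by
  obtain ⟨δ, hδ, hy⟩ := exists_unitPart_mem hg
  rw [powSeries, PowerSeries.binomialSeries_zero, hevalSeries_one hδ hy, mul_one, mul_zero,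
    complexPow_zero, seriesMonomial_zero_one]

theorem powSeries_one {g : ArtinianAlgebra} {e : ℝ} (hg : ArtinianHasDegree g e) (n : ℤ) :
    powSeries g e 1 n = g := by
  obtain ⟨δ, hδ, hy⟩ := exists_unitPart_mem hg
  have : PowerSeries.binomialSeries ℂ (1 : ℝ) = 1 + PowerSeries.X := by
    simpa using PowerSeries.binomialSeries_nat (R := ℝ) (A := ℂ) 1
  rw [powSeries, this, hevalSeries_one_add_X hδ hy, mul_one, complexPow_one,
    monomial_mul_one_add_unitPart hg]

/-- The branches differ only by the character `t ↦ e^{2πint}`, so the converse can work with branch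
`0` and recover `n` at the end. -/
theorem powSeries_eq_smul (g : ArtinianAlgebra) (e t : ℝ) (n : ℤ) :
    powSeries g e t n
      = Complex.exp (Complex.I * ((t * (2 * n * Real.pi) : ℝ) : ℂ)) • powSeries g e t 0 := by
  refine series_ext fun b => ?_
  rw [coeff_smul, powSeries, powSeries, coeff_monomial_mul, coeff_monomial_mul,
    complexPow_eq_mul_exp]
  ring

/-- The gap `δ` depends only on `g`, not on `t` or `n`; this uniformity drives the successive
approximation later. -/
theorem exists_powSeries_sub_mem {g : ArtinianAlgebra} {e : ℝ} (hg : ArtinianHasDegree g e) :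
    ∃ δ > 0, ∀ (t : ℝ) (n : ℤ),
      powSeries g e t n - seriesMonomial (e * t) (complexPow (g.1.coeff e) t n)
        ∈ seriesGE (e * t + δ) := by
  obtain ⟨δ, hδ, hy⟩ := exists_unitPart_mem hg
  refine ⟨δ, hδ, fun t n => ?_⟩
  have h := mul_mem_seriesGE
    (seriesMonomial_mem_seriesGE (e * t) (complexPow (g.1.coeff e) t n))
    (hevalSeries_sub_sum_mem hδ hy (PowerSeries.binomialSeries ℂ t) 1)
  rw [Nat.cast_one, one_mul] at h
  convert h using 1
  rw [Finset.sum_range_one, pow_zero, PowerSeries.binomialSeries_coeff, Ring.choose_zero_right,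
    one_smul, one_smul, powSeries]
  ring

theorem powSeries_mem_seriesGE {g : ArtinianAlgebra} {e : ℝ} (hg : ArtinianHasDegree g e)
    (t : ℝ) (n : ℤ) : powSeries g e t n ∈ seriesGE (e * t) := by
  obtain ⟨δ, hδ, h⟩ := exists_powSeries_sub_mem hg
  have h1 := seriesGE_anti (M := e * t) (by linarith) (h t n)
  simpa using Submodule.add_mem _ h1
    (seriesMonomial_mem_seriesGE (e * t) (complexPow (g.1.coeff e) t n))

theorem coeff_powSeries_self {g : ArtinianAlgebra} {e : ℝ} (hg : ArtinianHasDegree g e)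
    (t : ℝ) (n : ℤ) :
    (powSeries g e t n).1.coeff (e * t) = complexPow (g.1.coeff e) t n := by
  obtain ⟨δ, hδ, h⟩ := exists_powSeries_sub_mem hg
  have h1 := h t n (e * t) (by linarith)
  rwa [coeff_sub, coeff_seriesMonomial, if_pos rfl, sub_eq_zero] at h1

/-! ### Coefficients of the powers as sums over multisets -/

theorem prod_seriesMonomial (f : ℝ → ℂ) (m : Multiset ℝ) :
    (m.map fun a => seriesMonomial a (f a)).prod = seriesMonomial m.sum (m.map f).prod := by
  induction m using Multiset.induction with
  | empty => simp [seriesMonomial_zero_one]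
  | cons a m ih => simp [ih, seriesMonomial_mul]

theorem prod_factorial_mul_countPerms (m : Multiset ℝ) :
    (∏ a ∈ m.toFinset, (m.count a).factorial) * m.countPerms = (Multiset.card m).factorial := by
  have h := Nat.multinomial_spec m.toFinset fun a => m.count a
  rw [Multiset.toFinset_sum_count_eq] at h
  rw [← h, Multiset.countPerms, Finsupp.multinomial_eq, Multiset.toFinsupp_support]
  rfl

theorem real_choose_eq (t : ℝ) (k : ℕ) :
    Ring.choose t k = (∏ i ∈ Finset.range k, (t - (i : ℝ))) / (k.factorial : ℝ) := by
  rw [Ring.choose_eq_smul, ← descPochhammer_eval_eq_prod_range, smul_eq_mul, div_eq_inv_mul]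
  congr 1
  rw [← Polynomial.aeval_eq_smeval, Polynomial.aeval_def, Polynomial.eval₂_eq_eval_map,
    descPochhammer_map]

/-- The term of degree `k` of the binomial series contributes a multiset of size `k` once for each
of its orderings; this absorbs the factor `k!`. -/
theorem choose_mul_countPerms (t : ℝ) (m : Multiset ℝ) :
    Ring.choose t (Multiset.card m) * m.countPerms = multinomialCoeff t m := by
  have h : ((∏ a ∈ m.toFinset, ((m.count a).factorial : ℝ)) * m.countPerms)
      = ((Multiset.card m).factorial : ℝ) := by
    exact_mod_cast prod_factorial_mul_countPerms m
  have h1 : (∏ a ∈ m.toFinset, ((m.count a).factorial : ℝ)) ≠ 0 :=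
    Finset.prod_ne_zero_iff.2 fun a _ => by exact_mod_cast (Nat.factorial_pos _).ne'
  have h2 : ((Multiset.card m).factorial : ℝ) ≠ 0 := by exact_mod_cast (Nat.factorial_pos _).ne'
  rw [real_choose_eq, multinomialCoeff, div_mul_eq_mul_div, div_eq_div_iff h2 h1, ← h]
  ring

theorem continuous_choose (k : ℕ) : Continuous fun t : ℝ => Ring.choose t k := by
  simp only [real_choose_eq]
  fun_prop

theorem pow_sub_pow_truncLE_mem {y : ArtinianAlgebra} (hy : y ∈ seriesGE 0) (N : ℝ) (k : ℕ) :
    y ^ k - truncLE y N ^ k ∈ seriesGE N := by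
  have hz : truncLE y N ∈ seriesGE 0 := fun b hb => by
    rw [coeff_truncLE, hy b hb, ite_self]
  induction k with
  | zero => simp
  | succ k ih =>
    have h1 := mul_mem_seriesGE (pow_mem_seriesGE hy k) (sub_truncLE_mem y N)
    have h2 := mul_mem_seriesGE ih hz
    rw [mul_zero, zero_add] at h1
    rw [add_zero] at h2
    convert Submodule.add_mem _ h1 h2 using 1
    ring

/-- Below `N` the series `y` may be replaced by its truncation, a finite sum, to which the
multinomial theorem applies. -/
theorem coeff_pow_eq_sum {y : ArtinianAlgebra} (hy : y ∈ seriesGE 0) {u N : ℝ} (hu : u < N)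
    (k : ℕ) : (y ^ k).1.coeff u = ∑ m ∈ (exponentsLE y N).sym k,
      if u = m.1.sum then (m.1.countPerms : ℂ) * (m.1.map y.1.coeff).prod else 0 := by
  have h := pow_sub_pow_truncLE_mem hy N k u hu
  rw [coeff_sub, sub_eq_zero] at h
  rw [h, truncLE, Finset.sum_pow, coeff_sum]
  refine Finset.sum_congr rfl fun m _ => ?_
  rw [prod_seriesMonomial, ← nsmul_eq_mul, ← Nat.cast_smul_eq_nsmul ℂ, coeff_smul,
    coeff_seriesMonomial, mul_ite, mul_zero]

theorem card_mul_le_sum {δ : ℝ} {M : Multiset ℝ} (h : ∀ a ∈ M, δ ≤ a) :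
    Multiset.card M * δ ≤ M.sum := by
  rw [← nsmul_eq_mul]
  exact Multiset.card_nsmul_le_sum h

/-- In a nonzero summand every element of `M` is an exponent of `y`, hence at least `δ > 0`. As the
sum is prescribed, both the elements and their number are bounded. -/
theorem powTerm_support {g : ArtinianAlgebra} {e δ t b : ℝ} (hδ : 0 < δ)
    (hy : unitPart g e ∈ seriesGE δ) {M : Multiset ℝ} (hM : M ∈ powIndex e t b)
    (hne : powTerm (artinianCoeff g) e t M ≠ 0) :
    (∀ a ∈ M, a ∈ exponentsLE (unitPart g e) (b - e * t + 1)) ∧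
      Multiset.card M * δ ≤ b - e * t := by
  obtain ⟨h0, hsum⟩ := hM
  have hc (a : ℝ) (ha : a ∈ M) : (unitPart g e).1.coeff a ≠ 0 := by
    have ha0 : a ≠ 0 := fun h => h0 (h ▸ ha)
    rw [coeff_unitPart, if_neg ha0, sub_zero]
    intro h
    refine hne (mul_eq_zero_of_right _ (Multiset.prod_eq_zero ?_))
    exact Multiset.mem_map.2 ⟨a, ha, h⟩
  have hge (a : ℝ) (ha : a ∈ M) : δ ≤ a := by
    by_contra hlt
    exact hc a ha (hy a (not_le.1 hlt))
  have hle (a : ℝ) (ha : a ∈ M) : a ≤ M.sum :=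
    Multiset.single_le_sum (fun x hx => hδ.le.trans (hge x hx)) a ha
  have hs := card_mul_le_sum hge
  refine ⟨fun a ha => mem_exponentsLE.2 ⟨?_, hc a ha⟩, ?_⟩
  · have := hle a ha
    linarith
  · linarith

theorem zero_notMem_exponentsLE {δ N : ℝ} (hδ : 0 < δ) {y : ArtinianAlgebra}
    (hy : y ∈ seriesGE δ) : (0 : ℝ) ∉ exponentsLE y N := fun h =>
  (mem_exponentsLE.1 h).2 (hy 0 hδ)

/-- The multisets of fewer than `K` elements of a finite set. -/
def boundedMultisets (s : Finset ℝ) (K : ℕ) : Finset (Multiset ℝ) :=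
  ((Finset.range K).sigma fun k => s.sym k).image fun p => p.2.1

theorem mem_boundedMultisets {s : Finset ℝ} {K : ℕ} {M : Multiset ℝ} :
    M ∈ boundedMultisets s K ↔ Multiset.card M < K ∧ ∀ a ∈ M, a ∈ s := by
  constructor
  · intro h
    obtain ⟨⟨k, m⟩, hp, rfl⟩ := Finset.mem_image.1 h
    rw [Finset.mem_sigma, Finset.mem_range, Finset.mem_sym_iff] at hp
    refine ⟨?_, hp.2⟩
    rw [m.2]
    exact hp.1
  · rintro ⟨h1, h2⟩
    refine Finset.mem_image.2 ⟨⟨Multiset.card M, ⟨M, rfl⟩⟩, ?_, rfl⟩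
    rw [Finset.mem_sigma, Finset.mem_range, Finset.mem_sym_iff]
    exact ⟨h1, h2⟩

theorem sum_boundedMultisets (s : Finset ℝ) (K : ℕ) (F : Multiset ℝ → ℂ) :
    ∑ M ∈ boundedMultisets s K, F M = ∑ k ∈ Finset.range K, ∑ m ∈ s.sym k, F m.1 := by
  rw [boundedMultisets, Finset.sum_image, Finset.sum_sigma]
  rintro ⟨k, m⟩ - ⟨l, m'⟩ - (h : m.1 = m'.1)
  obtain rfl : k = l := by rw [← m.2, ← m'.2, h]
  rw [Subtype.ext h]

theorem powIndex_inter_support_subset {g : ArtinianAlgebra} {e δ t b : ℝ} {K : ℕ} (hδ : 0 < δ)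
    (hy : unitPart g e ∈ seriesGE δ) (hK : b - e * t < K * δ) :
    powIndex e t b ∩ Function.support (powTerm (artinianCoeff g) e t)
      ⊆ boundedMultisets (exponentsLE (unitPart g e) (b - e * t + 1)) K := by
  rintro M ⟨hM, hne⟩
  obtain ⟨h1, h2⟩ := powTerm_support hδ hy hM hne
  refine mem_boundedMultisets.2 ⟨?_, h1⟩
  have := lt_of_mul_lt_mul_right (h2.trans_lt hK) hδ.le
  exact_mod_cast this

theorem powIndex_inter_support_finite {g : ArtinianAlgebra} {e : ℝ}
    (hg : ArtinianHasDegree g e) (t b : ℝ) :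
    (powIndex e t b ∩ Function.support (powTerm (artinianCoeff g) e t)).Finite := by
  obtain ⟨δ, hδ, hy⟩ := exists_unitPart_mem hg
  obtain ⟨K, hK⟩ := exists_nat_gt ((b - e * t) / δ)
  rw [div_lt_iff₀ hδ] at hK
  exact (Finset.finite_toSet _).subset (powIndex_inter_support_subset hδ hy hK)

theorem powTerm_eq {g : ArtinianAlgebra} {e : ℝ} (t : ℝ) {M : Multiset ℝ} (hM : (0 : ℝ) ∉ M) :
    powTerm (artinianCoeff g) e t M = ((Ring.choose t (Multiset.card M) : ℝ) : ℂ) *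
      (M.countPerms * (M.map (unitPart g e).1.coeff).prod) := by
  rw [powTerm, ← choose_mul_countPerms, ← mul_assoc]
  push_cast
  congr 2
  refine Multiset.map_congr rfl fun a ha => ?_
  have ha0 : a ≠ 0 := fun h => hM (h ▸ ha)
  rw [coeff_unitPart, if_neg ha0, sub_zero]
  rfl

theorem powCoeff_eq {g : ArtinianAlgebra} {e : ℝ} (hg : ArtinianHasDegree g e) (t b : ℝ)
    (n : ℤ) : powCoeff (artinianCoeff g) e t n b = (powSeries g e t n).1.coeff b := by
  obtain ⟨δ, hδ, hy⟩ := exists_unitPart_mem hg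
  obtain ⟨K, hK⟩ := exists_nat_gt ((b - e * t) / δ)
  rw [div_lt_iff₀ hδ] at hK
  rw [powCoeff, powSeries, coeff_monomial_mul, coeff_hevalSeries hδ hy _ K hK]
  congr 1
  classical
  -- The summand `1` provides the strict inequality in `coeff_pow_eq_sum`: truncation at `N` is
  -- controlled only below `N`.
  set s := exponentsLE (unitPart g e) (b - e * t + 1) with hs
  rw [finsum_mem_eq_sum_of_inter_support_eq (t := (boundedMultisets s K).filter
    fun M => b - e * t = M.sum), Finset.sum_filter, sum_boundedMultisets]
  · refine Finset.sum_congr rfl fun k _ => ?_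
    rw [coeff_pow_eq_sum (seriesGE_anti hδ.le hy) (N := b - e * t + 1) (by linarith), ← hs,
      Finset.mul_sum]
    refine Finset.sum_congr rfl fun m hm => ?_
    rw [mul_ite, mul_zero]
    congr 1
    rw [powTerm_eq, m.2, PowerSeries.binomialSeries_coeff, Complex.real_smul, mul_one]
    intro h0
    exact zero_notMem_exponentsLE hδ hy (Finset.mem_sym_iff.1 hm 0 h0)
  · ext M
    constructor
    · rintro ⟨hM, hne⟩
      refine ⟨?_, hne⟩
      have h1 := powIndex_inter_support_subset hδ hy hK ⟨hM, hne⟩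
      rw [Finset.mem_coe, Finset.mem_filter]
      refine ⟨h1, ?_⟩
      rw [← hM.2]
      ring
    · rintro ⟨hM, hne⟩
      rw [Finset.mem_coe, Finset.mem_filter, mem_boundedMultisets] at hM
      refine ⟨⟨fun h0 => zero_notMem_exponentsLE hδ hy (hM.1.2 0 h0), ?_⟩, hne⟩
      rw [← hM.2]
      ring

/-! ### Convergence in the series topology -/

/-- An additive map from an algebra of series to a topological group is continuous if it respects
the two kinds of convergent sequences that define the topology. -/
theorem continuous_of_seriesTopology {Γ : Type} [AddCommGroup Γ] [LinearOrder Γ]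
    [IsOrderedAddMonoid Γ] [TopologicalSpace Γ] {G : Type*} [AddCommGroup G]
    [τ : TopologicalSpace G] [IsTopologicalAddGroup G] (φ : seriesAlgebra Γ → G)
    (hadd : ∀ f g, φ (f + g) = φ f + φ g)
    (hmono : ∀ (a : ℕ → Γ) (c : ℕ → ℂ) (α : Γ) (γ : ℂ),
      Tendsto a atTop (𝓝 α) → Tendsto c atTop (𝓝 γ) →
        Tendsto (fun k => φ (seriesMonomial (a k) (c k))) atTop (𝓝 (φ (seriesMonomial α γ))))
    (htail : ∀ s : ℕ → seriesAlgebra Γ,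
      (∀ N : Γ, ∀ᶠ k in atTop, ∀ a ≤ N, (s k).1.coeff a = 0) →
        Tendsto (fun k => φ (s k)) atTop (𝓝 0)) :
    Continuous[seriesTopology Γ, τ] φ := by
  let ψ : seriesAlgebra Γ →+ G := AddMonoidHom.mk' φ hadd
  have h0 : φ 0 = 0 := ψ.map_zero
  rw [continuous_iff_le_induced]
  -- The topology induced by `φ` meets the requirements, so the finest such topology refines it.
  refine sInf_le ⟨topologicalAddGroup_induced ψ, fun a c α γ ha hc => ?_, fun s hs => ?_⟩
  · rw [nhds_induced, tendsto_comap_iff]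
    exact hmono a c α γ ha hc
  · rw [nhds_induced, tendsto_comap_iff, h0]
    exact htail s hs

section

attribute [local instance] artinianTopology

theorem isTopologicalAddGroup_artinian : IsTopologicalAddGroup ArtinianAlgebra :=
  (isSeriesTopology_seriesTopology ℝ).group

attribute [local instance] isTopologicalAddGroup_artinian

theorem continuousAdd_artinian : ContinuousAdd ArtinianAlgebra :=
  isTopologicalAddGroup_artinian.toContinuousAdd

attribute [local instance] continuousAdd_artinian

theorem tendsto_seriesMonomial {a : ℕ → ℝ} {c : ℕ → ℂ} {α : ℝ} {γ : ℂ}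
    (ha : Tendsto a atTop (𝓝 α)) (hc : Tendsto c atTop (𝓝 γ)) :
    Tendsto (fun k => seriesMonomial (a k) (c k)) atTop (𝓝 (seriesMonomial α γ)) :=
  (isSeriesTopology_seriesTopology ℝ).monomial a c α γ ha hc

theorem tendsto_zero_of_mem_seriesGE {s : ℕ → ArtinianAlgebra}
    (hs : ∀ N, ∀ᶠ k in atTop, s k ∈ seriesGE N) : Tendsto s atTop (𝓝 0) := by
  refine (isSeriesTopology_seriesTopology ℝ).tail s fun N => ?_
  filter_upwards [hs (N + 1)] with k hk a ha
  exact hk a (by linarith)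

/-- Otherwise there are series `s k` with exponents at least `k` outside `U`; but they tend to `0`.
-/
theorem exists_seriesGE_subset {U : Set ArtinianAlgebra} (hU : U ∈ 𝓝 (0 : ArtinianAlgebra)) :
    ∃ N, ∀ f ∈ seriesGE N, f ∈ U := by
  by_contra! h
  choose s hs hs' using fun k : ℕ => h (k : ℝ)
  have ht : Tendsto s atTop (𝓝 0) := by
    refine tendsto_zero_of_mem_seriesGE fun N => ?_
    obtain ⟨K, hK⟩ := exists_nat_gt N
    filter_upwards [eventually_ge_atTop K] with k hk
    refine seriesGE_anti (hK.le.trans ?_) (hs k)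
    exact_mod_cast hk
  obtain ⟨k, hk⟩ := (ht.eventually_mem hU).exists
  exact hs' k hk

/-- Convergence may be checked modulo arbitrarily high exponents, which reduces limits of infinite
series to limits of finite sums. -/
theorem tendsto_of_approx {ι : Type*} {l : Filter ι} {F : ι → ArtinianAlgebra}
    {F₀ : ArtinianAlgebra}
    (h : ∀ N, ∃ (G : ι → ArtinianAlgebra) (G₀ : ArtinianAlgebra),
      (∀ᶠ k in l, F k - G k ∈ seriesGE N) ∧ F₀ - G₀ ∈ seriesGE N ∧ Tendsto G l (𝓝 G₀)) :
    Tendsto F l (𝓝 F₀) := by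
  rw [← tendsto_sub_nhds_zero_iff]
  intro U hU
  obtain ⟨V, hV, hVU⟩ := exists_nhds_zero_half hU
  obtain ⟨N, hN⟩ := exists_seriesGE_subset hV
  obtain ⟨G, G₀, h1, h2, h3⟩ := h N
  have h4 := tendsto_sub_nhds_zero_iff.2 h3 hV
  rw [mem_map]
  filter_upwards [h1, h4] with k hk hk'
  have h5 := hVU _ (hN _ (sub_mem_seriesGE hk h2)) _ hk'
  have h6 : F k - G k - (F₀ - G₀) + (G k - G₀) = F k - F₀ := by ring
  rw [Set.mem_preimage, ← h6]
  exact h5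

theorem tendsto_monomial_mul {a : ℕ → ℝ} {c : ℕ → ℂ} {α : ℝ} {γ : ℂ}
    (ha : Tendsto a atTop (𝓝 α)) (hc : Tendsto c atTop (𝓝 γ)) (s : ArtinianAlgebra) :
    Tendsto (fun k => seriesMonomial (a k) (c k) * s) atTop (𝓝 (seriesMonomial α γ * s)) := by
  refine tendsto_of_approx fun N => ?_
  -- Eventually `a k > α - 1`, so a remainder starting at `N - α + 1` is pushed beyond `N`.
  set t := truncLE s (N - α + 1) with ht
  have hst : s - t ∈ seriesGE (N - α + 1) := sub_truncLE_mem s _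
  have hsub (p : ArtinianAlgebra) : p * s - p * t = p * (s - t) := by ring
  refine ⟨fun k => seriesMonomial (a k) (c k) * t, seriesMonomial α γ * t, ?_, ?_, ?_⟩
  · filter_upwards [ha.eventually_const_lt (show α - 1 < α by linarith)] with k hk
    rw [hsub]
    exact seriesGE_anti (by linarith)
      (mul_mem_seriesGE (seriesMonomial_mem_seriesGE (a k) (c k)) hst)
  · rw [hsub]
    exact seriesGE_anti (by linarith)
      (mul_mem_seriesGE (seriesMonomial_mem_seriesGE α γ) hst)
  · rw [ht, truncLE]
    simp only [Finset.mul_sum, seriesMonomial_mul]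
    exact tendsto_finsetSum _ fun b _ =>
      tendsto_seriesMonomial (ha.add_const b) (hc.mul_const _)

theorem tendsto_smul_powSeries {g : ArtinianAlgebra} {e : ℝ} (hg : ArtinianHasDegree g e)
    (n : ℤ) {t : ℕ → ℝ} {c : ℕ → ℂ} {t₀ : ℝ} {γ : ℂ}
    (ht : Tendsto t atTop (𝓝 t₀)) (hc : Tendsto c atTop (𝓝 γ)) :
    Tendsto (fun k => c k • powSeries g e (t k) n) atTop (𝓝 (γ • powSeries g e t₀ n)) := by
  obtain ⟨δ, hδ, hy⟩ := exists_unitPart_mem hg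
  refine tendsto_of_approx fun N => ?_
  -- Eventually `e * t k > e * t₀ - 1`, so the first `K` binomial terms suffice modulo exponents at
  -- least `N`; their coefficients are continuous in `t`.
  obtain ⟨K, hK⟩ := exists_nat_gt ((N - e * t₀ + 1) / δ)
  rw [div_lt_iff₀ hδ] at hK
  set y := unitPart g e with hydef
  have key (t : ℝ) (c : ℂ) : c • powSeries g e t n - ∑ j ∈ Finset.range K,
      seriesMonomial (e * t) (c * complexPow (g.1.coeff e) t n * (Ring.choose t j : ℝ)) * y ^ j
        ∈ seriesGE (e * t + K * δ) := by
    have h := mul_mem_seriesGE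
      (seriesMonomial_mem_seriesGE (e * t) (c * complexPow (g.1.coeff e) t n))
      (hevalSeries_sub_sum_mem hδ hy (PowerSeries.binomialSeries ℂ t) K)
    convert h using 1
    rw [seriesMonomial_eq_smul, powSeries, seriesMonomial_eq_smul _ (complexPow _ _ _), ← hydef]
    have h2 : ∀ p q r : ArtinianAlgebra, p * (q - r) = p * q - p * r := fun p q r => by ring
    rw [h2, Finset.mul_sum]
    congr 1
    · rw [smul_mul_assoc, smul_mul_assoc, smul_smul]
    · refine Finset.sum_congr rfl fun j _ => ?_
      rw [seriesMonomial_eq_smul, PowerSeries.binomialSeries_coeff, Complex.real_smul, mul_one,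
        smul_mul_assoc, smul_mul_assoc, mul_smul_comm, smul_smul]
  refine ⟨fun k => ∑ j ∈ Finset.range K, seriesMonomial (e * t k)
      (c k * complexPow (g.1.coeff e) (t k) n * (Ring.choose (t k) j : ℝ)) * y ^ j,
    ∑ j ∈ Finset.range K, seriesMonomial (e * t₀)
      (γ * complexPow (g.1.coeff e) t₀ n * (Ring.choose t₀ j : ℝ)) * y ^ j, ?_, ?_, ?_⟩
  · filter_upwards [(ht.const_mul e).eventually_const_lt
      (show e * t₀ - 1 < e * t₀ by linarith)] with k hk
    exact seriesGE_anti (by linarith) (key (t k) (c k))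
  · exact seriesGE_anti (by linarith) (key t₀ γ)
  · refine tendsto_finsetSum _ fun j _ => tendsto_monomial_mul (ht.const_mul e) ?_ _
    have h1 := ((continuous_complexPow (artinianHasDegree_iff.1 hg).1 n).tendsto t₀).comp ht
    have h2 := ((Complex.continuous_ofReal.comp (continuous_choose j)).tendsto t₀).comp ht
    exact (hc.mul h1).mul h2

end

/-! ### Substitution of a one-parameter group -/

/-- A one-parameter group `a ↦ P a` of series of degrees `d a` with `d > 0`, whose terms after the
leading one `L a x^{d a}` have exponents at least `d a + δ`. -/
structure IsPowerFamily (P : ℝ → ArtinianAlgebra) (d δ : ℝ) (L : ℝ → ℂ) : Prop where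
  d_pos : 0 < d
  δ_pos : 0 < δ
  zero : P 0 = 1
  add : ∀ a b, P (a + b) = P a * P b
  ne_zero : ∀ a, L a ≠ 0
  sub_mem : ∀ a, P a - seriesMonomial (d * a) (L a) ∈ seriesGE (d * a + δ)

namespace IsPowerFamily

variable {P : ℝ → ArtinianAlgebra} {d δ : ℝ} {L : ℝ → ℂ}

theorem coeff_eq (h : IsPowerFamily P d δ L) {a b : ℝ} (hb : b < d * a + δ) :
    (P a).1.coeff b = if b = d * a then L a else 0 := by
  have := h.sub_mem a b hb
  rwa [coeff_sub, sub_eq_zero, coeff_seriesMonomial] at this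

theorem mem_seriesGE (h : IsPowerFamily P d δ L) (a : ℝ) : P a ∈ seriesGE (d * a) := by
  intro b hb
  rw [h.coeff_eq (hb.trans (by linarith [h.δ_pos])), if_neg hb.ne]

theorem support_subset (h : IsPowerFamily P d δ L) (f : ArtinianAlgebra) {b N : ℝ}
    (hb : b ≤ d * N) :
    (Function.support fun a => f.1.coeff a * (P a).1.coeff b) ⊆ exponentsLE f N := by
  intro a ha
  refine mem_exponentsLE.2 ⟨?_, left_ne_zero_of_mul ha⟩
  by_contra hlt
  have : d * N < d * a := mul_lt_mul_of_pos_left (not_le.1 hlt) h.d_pos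
  exact right_ne_zero_of_mul ha (h.mem_seriesGE a b (by linarith))

theorem support_finite (h : IsPowerFamily P d δ L) (f : ArtinianAlgebra) (b : ℝ) :
    (Function.support fun a => f.1.coeff a * (P a).1.coeff b).Finite :=
  (Finset.finite_toSet _).subset
    (h.support_subset f (N := b / d) (by rw [mul_div_cancel₀ _ h.d_pos.ne']))

theorem finsum_eq (h : IsPowerFamily P d δ L) (f : ArtinianAlgebra) {b N : ℝ}
    (hb : b ≤ d * N) : ∑ᶠ a, f.1.coeff a * (P a).1.coeff b
      = (∑ a ∈ exponentsLE f N, f.1.coeff a • P a).1.coeff b := by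
  rw [finsum_eq_sum_of_support_subset _ (h.support_subset f hb), coeff_sum]
  rfl

/-- The substitution `f ↦ ∑_a f_a P(a)`. -/
def compose (h : IsPowerFamily P d δ L) : ArtinianAlgebra →ₗ[ℂ] ArtinianAlgebra where
  toFun f := seriesOfCoeff (fun b => ∑ᶠ a, f.1.coeff a * (P a).1.coeff b) fun a => by
    refine ((∑ a ∈ exponentsLE f (a / d), f.1.coeff a • P a).2 a).subset ?_
    rintro b ⟨hb, hne⟩
    refine ⟨hb, ?_⟩
    rwa [h.finsum_eq f (N := a / d) (by rwa [mul_div_cancel₀ _ h.d_pos.ne'])] at hne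
  map_add' f g := by
    refine series_ext fun b => ?_
    simp only [coeff_add, coeff_seriesOfCoeff, add_mul]
    exact finsum_add_distrib (h.support_finite f b) (h.support_finite g b)
  map_smul' c f := by
    refine series_ext fun b => ?_
    simp only [coeff_smul, coeff_seriesOfCoeff, mul_assoc, RingHom.id_apply]
    exact (mul_finsum _ _).symm

theorem coeff_compose (h : IsPowerFamily P d δ L) (f : ArtinianAlgebra) (b : ℝ) :
    (h.compose f).1.coeff b = ∑ᶠ a, f.1.coeff a * (P a).1.coeff b := rfl

theorem compose_monomial (h : IsPowerFamily P d δ L) (a : ℝ) (c : ℂ) :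
    h.compose (seriesMonomial a c) = c • P a := by
  refine series_ext fun b => ?_
  rw [coeff_compose, coeff_smul, finsum_eq_single _ a, coeff_seriesMonomial, if_pos rfl]
  intro a' ha'
  rw [coeff_seriesMonomial, if_neg ha', zero_mul]

/-- Triangularity: for `a ≥ N` only the leading term of `P a` lies below `d * N + δ`, and distinct
`a` have distinct leading exponents. -/
theorem coeff_compose_of_lt (h : IsPowerFamily P d δ L) {f : ArtinianAlgebra} {N b : ℝ}
    (hf : f ∈ seriesGE N) (hb : b < d * N + δ) :
    (h.compose f).1.coeff b = f.1.coeff (b / d) * L (b / d) := by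
  have hd := h.d_pos
  have hbd : d * (b / d) = b := mul_div_cancel₀ _ hd.ne'
  rw [coeff_compose, finsum_eq_single _ (b / d)]
  · rw [h.coeff_eq (by rw [hbd]; linarith [h.δ_pos]), if_pos hbd.symm]
  · intro a ha
    by_cases haN : a < N
    · rw [hf a haN, zero_mul]
    · have : d * N ≤ d * a := mul_le_mul_of_nonneg_left (not_lt.1 haN) hd.le
      rw [h.coeff_eq (by linarith), if_neg, mul_zero]
      rintro rfl
      exact ha (by rw [mul_div_cancel_left₀ _ hd.ne'])

theorem compose_mem (h : IsPowerFamily P d δ L) {f : ArtinianAlgebra} {N : ℝ}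
    (hf : f ∈ seriesGE N) : h.compose f ∈ seriesGE (d * N) := by
  intro b hb
  rw [h.coeff_compose_of_lt hf (by linarith [h.δ_pos]), hf, zero_mul]
  rwa [div_lt_iff₀' h.d_pos]

theorem exists_compose_mem (h : IsPowerFamily P d δ L) (N : ℝ) :
    ∃ M, ∀ f ∈ seriesGE M, h.compose f ∈ seriesGE N :=
  ⟨N / d, fun f hf => by simpa [mul_div_cancel₀ _ h.d_pos.ne'] using h.compose_mem hf⟩

theorem exists_compose_mul_mem (h : IsPowerFamily P d δ L) (g : ArtinianAlgebra) (N : ℝ) :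
    ∃ M, ∀ f ∈ seriesGE M, h.compose (f * g) ∈ seriesGE N := by
  obtain ⟨M, hM⟩ := h.exists_compose_mem N
  obtain ⟨M', hM'⟩ := exists_mem_seriesGE g
  exact ⟨M - M', fun f hf => hM _ (by simpa using mul_mem_seriesGE hf hM')⟩

theorem exists_compose_mul_compose_mem (h : IsPowerFamily P d δ L) (g : ArtinianAlgebra)
    (N : ℝ) : ∃ M, ∀ f ∈ seriesGE M, h.compose f * h.compose g ∈ seriesGE N := by
  obtain ⟨M', hM'⟩ := exists_mem_seriesGE (h.compose g)
  obtain ⟨M, hM⟩ := h.exists_compose_mem (N - M')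
  exact ⟨M, fun f hf => by simpa using mul_mem_seriesGE (hM f hf) hM'⟩

theorem compose_mul_monomial (h : IsPowerFamily P d δ L) (f : ArtinianAlgebra) (a : ℝ) (c : ℂ) :
    h.compose (f * seriesMonomial a c) = h.compose f * h.compose (seriesMonomial a c) := by
  refine linearMap_ext_of_monomial
    (φ := h.compose ∘ₗ LinearMap.mulRight ℂ (seriesMonomial a c))
    (ψ := LinearMap.mulRight ℂ (h.compose (seriesMonomial a c)) ∘ₗ h.compose)
    (h.exists_compose_mul_mem _) (h.exists_compose_mul_compose_mem _) (fun b c' => ?_) f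
  simp only [LinearMap.comp_apply, LinearMap.mulRight_apply, seriesMonomial_mul,
    compose_monomial, h.add]
  rw [smul_mul_smul_comm]

/-- For fixed `g` both sides are linear in `f` and respect the filtration, so `f` may be a monomial;
that case is `compose_mul_monomial` after commuting the factors. -/
theorem compose_mul (h : IsPowerFamily P d δ L) (f g : ArtinianAlgebra) :
    h.compose (f * g) = h.compose f * h.compose g := by
  refine linearMap_ext_of_monomial
    (φ := h.compose ∘ₗ LinearMap.mulRight ℂ g)
    (ψ := LinearMap.mulRight ℂ (h.compose g) ∘ₗ h.compose)
    (h.exists_compose_mul_mem _) (h.exists_compose_mul_compose_mem _) (fun b c' => ?_) f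
  simp only [LinearMap.comp_apply, LinearMap.mulRight_apply]
  rw [mul_comm, compose_mul_monomial, mul_comm]

theorem compose_one (h : IsPowerFamily P d δ L) : h.compose 1 = 1 := by
  rw [← seriesMonomial_zero_one, compose_monomial, h.zero, one_smul, seriesMonomial_zero_one]

theorem compose_injective (h : IsPowerFamily P d δ L) : Function.Injective h.compose := by
  have key (f : ArtinianAlgebra) (hf : h.compose f = 0) : f = 0 := by
    by_contra hne
    obtain ⟨N, hN, hN'⟩ := exists_isLeast_support hne
    have h1 := h.coeff_compose_of_lt hN (b := d * N) (by linarith [h.δ_pos])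
    rw [mul_div_cancel_left₀ _ h.d_pos.ne', hf] at h1
    exact mul_ne_zero hN' (h.ne_zero N) h1.symm
  intro f g hfg
  have h1 := key (f - g) (by rw [map_sub h.compose, hfg]; ring)
  refine series_ext fun b => ?_
  have h2 : (f - g).1.coeff b = 0 := by
    rw [h1]
    rfl
  rwa [coeff_sub, sub_eq_zero] at h2

/-- Dividing the coefficients of `u` by the leading coefficients `L` matches every term of `u` below
`M + δ` at once. A fixed gain is needed because removing single terms need not advance by a bounded
amount. -/
theorem exists_sub_compose_mem (h : IsPowerFamily P d δ L) {u : ArtinianAlgebra} {M : ℝ}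
    (hu : u ∈ seriesGE M) :
    ∃ f ∈ seriesGE (M / d), u - h.compose f ∈ seriesGE (M + δ) := by
  have hd := h.d_pos
  have hfin : ∀ a, {b | b ≤ a ∧ u.1.coeff (d * b) / L b ≠ 0}.Finite := by
    intro a
    refine ((u.2 (d * a)).image (· / d)).subset ?_
    rintro b ⟨hb, hne⟩
    refine ⟨d * b, ⟨mul_le_mul_of_nonneg_left hb hd.le, fun h0 => hne ?_⟩,
      mul_div_cancel_left₀ _ hd.ne'⟩
    rw [h0, zero_div]
  have hf : seriesOfCoeff _ hfin ∈ seriesGE (M / d) := by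
    intro b hb
    rw [lt_div_iff₀' hd] at hb
    rw [coeff_seriesOfCoeff, hu _ hb, zero_div]
  refine ⟨_, hf, fun b hb => ?_⟩
  rw [coeff_sub, h.coeff_compose_of_lt hf (by rwa [mul_div_cancel₀ _ hd.ne']),
    coeff_seriesOfCoeff, div_mul_cancel₀ _ (h.ne_zero _), mul_div_cancel₀ _ hd.ne', sub_self]

theorem compose_surjective (h : IsPowerFamily P d δ L) : Function.Surjective h.compose := by
  intro u
  obtain ⟨M, hM⟩ := exists_mem_seriesGE u
  have hd := h.d_pos
  have hδ := h.δ_pos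
  choose! F hF hF' using fun (v : ArtinianAlgebra) (N : ℝ) (hv : v ∈ seriesGE N) =>
    h.exists_sub_compose_mem hv
  -- `v k` is the error left after `k` corrections; its exponents are at least `M + k * δ`.
  let v : ℕ → ArtinianAlgebra := fun k =>
    Nat.rec u (fun k v => v - h.compose (F v (M + k * δ))) k
  have hv_succ (k : ℕ) : v (k + 1) = v k - h.compose (F (v k) (M + k * δ)) := rfl
  have hv (k : ℕ) : v k ∈ seriesGE (M + k * δ) := by
    induction k with
    | zero => simpa [v] using hM
    | succ k ih =>
      rw [hv_succ]
      convert hF' _ _ ih using 2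
      push_cast
      ring
  obtain ⟨f, hf⟩ := exists_limit_of_seriesGE (fun k => F (v k) (M + k * δ))
    (fun k => (M + k * δ) / d) (fun k l hkl => by
      have : (k : ℝ) ≤ l := by exact_mod_cast hkl
      beta_reduce
      gcongr)
    (Tendsto.atTop_div_const hd (tendsto_atTop_add_const_left _ _
      (Tendsto.atTop_mul_const hδ tendsto_natCast_atTop_atTop)))
    fun k => hF _ _ (hv k)
  have hsum (K : ℕ) :
      u - h.compose (∑ k ∈ Finset.range K, F (v k) (M + k * δ)) = v K := by
    induction K with
    | zero =>
      rw [Finset.sum_range_zero, map_zero]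
      change u - 0 = u
      ring
    | succ K ih =>
      rw [Finset.sum_range_succ, map_add, hv_succ, ← ih]
      ring
  refine ⟨f, (eq_of_forall_sub_mem_seriesGE fun N => ?_).symm⟩
  obtain ⟨K, hK⟩ := exists_nat_gt ((N - M) / δ)
  rw [div_lt_iff₀ hδ] at hK
  have h1 := h.compose_mem (hf K)
  rw [map_sub h.compose, mul_div_cancel₀ _ hd.ne'] at h1
  refine seriesGE_anti (N := M + K * δ) (by linarith) ?_
  convert sub_mem_seriesGE (hv K) h1 using 1
  rw [← hsum K]
  ring

/-- The substitution `f ↦ ∑_a f_a P(a)` as an automorphism. -/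
def composeEquiv (h : IsPowerFamily P d δ L) : ArtinianAlgebra ≃ₐ[ℂ] ArtinianAlgebra :=
  AlgEquiv.ofBijective (AlgHom.ofLinearMap h.compose h.compose_one h.compose_mul)
    ⟨h.compose_injective, h.compose_surjective⟩

section

attribute [local instance] artinianTopology isTopologicalAddGroup_artinian

theorem continuous_compose (h : IsPowerFamily P d δ L)
    (hc : ∀ (a : ℕ → ℝ) (c : ℕ → ℂ) (α : ℝ) (γ : ℂ), Tendsto a atTop (𝓝 α) →
      Tendsto c atTop (𝓝 γ) → Tendsto (fun k => c k • P (a k)) atTop (𝓝 (γ • P α))) :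
    Continuous h.compose := by
  refine continuous_of_seriesTopology h.compose (map_add h.compose) (fun a c α γ ha hγ => ?_)
    fun s hs => ?_
  · simp only [compose_monomial]
    exact hc a c α γ ha hγ
  · refine tendsto_zero_of_mem_seriesGE fun N => ?_
    obtain ⟨M, hM⟩ := h.exists_compose_mem N
    filter_upwards [hs M] with k hk
    exact hM _ fun b hb => hk b hb.le

end

end IsPowerFamily

theorem isPowerFamily_powSeries {g : ArtinianAlgebra} {e : ℝ} (hg : ArtinianHasDegree g e)
    {ε : ℝ} (hε : 0 < ε * e) (n : ℤ) :
    ∃ δ, IsPowerFamily (fun a => powSeries g e (ε * a) n) (ε * e) δ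
      fun a => complexPow (g.1.coeff e) (ε * a) n := by
  obtain ⟨δ, hδ, h⟩ := exists_powSeries_sub_mem hg
  refine ⟨δ, hε, hδ, ?_, fun a b => ?_, fun a => ?_, fun a => ?_⟩
  · rw [mul_zero, powSeries_zero hg]
  · rw [mul_add, powSeries_add hg]
  · exact complexPow_ne_zero (artinianHasDegree_iff.1 hg).1 _ _
  · have he : ε * e * a = e * (ε * a) := by ring
    rw [he]
    exact h (ε * a) n

/-- Substitution of a power of a series into series, for an arbitrary sign of the degree. -/
theorem exists_composition {g : ArtinianAlgebra} {e : ℝ} (hg : ArtinianHasDegree g e)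
    {ε : ℝ} (hε : 0 < ε * e) (n : ℤ) :
    ∃ σ : ArtinianAlgebra ≃ₐ[ℂ] ArtinianAlgebra,
      Continuous[artinianTopology, artinianTopology] σ ∧
      (∀ a c, σ (seriesMonomial a c) = c • powSeries g e (ε * a) n) ∧
      ∀ f b, (Function.support fun a =>
          artinianCoeff f a * powCoeff (artinianCoeff g) e (ε * a) n b).Finite ∧
        artinianCoeff (σ f) b =
          ∑ᶠ a, artinianCoeff f a * powCoeff (artinianCoeff g) e (ε * a) n b := by
  obtain ⟨δ, h⟩ := isPowerFamily_powSeries hg hε n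
  refine ⟨h.composeEquiv, h.continuous_compose fun a c α γ ha hγ =>
    tendsto_smul_powSeries hg n (ha.const_mul ε) hγ, fun a c => h.compose_monomial a c,
    fun f b => ?_⟩
  simp only [powCoeff_eq hg]
  exact ⟨h.support_finite f b, h.coeff_compose f b⟩

/-! ### Continuous characters of the real line -/

theorem hasDerivAt_of_continuous_mul {χ : ℝ → ℂ} (hc : Continuous χ)
    (h0 : χ 0 = 1) (hadd : ∀ s t, χ (s + t) = χ s * χ t) :
    ∃ c : ℂ, ∀ t, HasDerivAt χ (c * χ t) t := by
  set F : ℝ → ℂ := fun t => ∫ x in (0 : ℝ)..t, χ x with hF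
  have hFd (t : ℝ) : HasDerivAt F (χ t) t :=
    intervalIntegral.integral_hasDerivAt_right (hc.intervalIntegrable _ _)
      hc.stronglyMeasurable.stronglyMeasurableAtFilter hc.continuousAt
  obtain ⟨s, hs⟩ : ∃ s, F s ≠ 0 := by
    by_contra! h
    have h1 : F = fun _ => 0 := funext h
    have h2 := hFd 0
    rw [h1, h0] at h2
    exact one_ne_zero (h2.unique (hasDerivAt_const _ _))
  -- Integrating `χ (t + x) = χ t * χ x` over `x` from `0` to `s` expresses `χ` through its
  -- differentiable primitive.
  have hχ (t : ℝ) : χ t = (F (t + s) - F t) / F s := by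
    rw [eq_div_iff hs, hF]
    beta_reduce
    rw [intervalIntegral.integral_interval_sub_left (hc.intervalIntegrable _ _)
      (hc.intervalIntegrable _ _), ← intervalIntegral.integral_const_mul]
    simp only [← hadd]
    rw [intervalIntegral.integral_comp_add_left χ t, add_zero]
  refine ⟨(χ s - 1) / F s, fun t => ?_⟩
  have h1 : HasDerivAt (fun t => (F (t + s) - F t) / F s) ((χ (t + s) - χ t) / F s) t :=
    (((hFd (t + s)).comp_add_const t s).sub (hFd t)).div_const _
  rw [← funext hχ] at h1
  convert h1 using 1
  rw [hadd]
  ring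

theorem exists_eq_exp_of_continuous_mul {χ : ℝ → ℂ} (hc : Continuous χ)
    (h1 : χ 1 = 1) (h0 : χ 0 = 1) (hadd : ∀ s t, χ (s + t) = χ s * χ t) :
    ∃ n : ℤ, ∀ t : ℝ, χ t = Complex.exp (Complex.I * ((t * (2 * n * Real.pi) : ℝ) : ℂ)) := by
  obtain ⟨c, hd⟩ := hasDerivAt_of_continuous_mul hc h0 hadd
  have hχ (t : ℝ) : χ t = Complex.exp (c * t) := by
    have hconst (t : ℝ) : HasDerivAt (fun t : ℝ => χ t * Complex.exp (-c * t)) 0 t := by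
      have h2 : HasDerivAt (fun t : ℝ => Complex.exp (-c * t)) (Complex.exp (-c * t) * (-c)) t := by
        simpa using ((Complex.ofRealCLM.hasDerivAt (x := t)).const_mul (-c)).cexp
      have h3 := (hd t).mul h2
      rwa [show c * χ t * Complex.exp (-c * t) + χ t * (Complex.exp (-c * t) * -c) = 0 by ring]
        at h3
    have h3 := is_const_of_deriv_eq_zero (fun t => (hconst t).differentiableAt)
      (fun t => (hconst t).deriv) t 0
    simp only [h0, Complex.ofReal_zero, mul_zero, Complex.exp_zero, mul_one] at h3
    calc χ t = χ t * Complex.exp (-c * t) * Complex.exp (c * t) := by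
          rw [mul_assoc, ← Complex.exp_add]
          simp
      _ = Complex.exp (c * t) := by rw [h3, one_mul]
  have h4 := hχ 1
  rw [h1, Complex.ofReal_one, mul_one] at h4
  obtain ⟨n, hn⟩ := Complex.exp_eq_one_iff.1 h4.symm
  refine ⟨n, fun t => ?_⟩
  rw [hχ, hn]
  congr 1
  push_cast
  ring

/-! ### The tent transform and the Hausdorff property -/

/-- The function `θ ↦ ∑_a f_a max(0, θ - a)` on `(-∞, B]`. -/
def tentTransform (B : ℝ) (f : ArtinianAlgebra) : UniformFun (Set.Iic B) ℂ :=
  UniformFun.ofFun fun θ => ∑ᶠ a, f.1.coeff a * ((max 0 (θ.1 - a) : ℝ) : ℂ)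

theorem tentTransform_apply (B : ℝ) (f : ArtinianAlgebra) (θ : Set.Iic B) :
    UniformFun.toFun (tentTransform B f) θ
      = ∑ᶠ a, f.1.coeff a * ((max 0 (θ.1 - a) : ℝ) : ℂ) := rfl

theorem tentTransform_support_finite (f : ArtinianAlgebra) (θ : ℝ) :
    (Function.support fun a => f.1.coeff a * ((max 0 (θ - a) : ℝ) : ℂ)).Finite := by
  refine (f.2 θ).subset fun a ha => ⟨?_, left_ne_zero_of_mul ha⟩
  by_contra hlt
  refine right_ne_zero_of_mul ha ?_
  rw [max_eq_left (by linarith [not_le.1 hlt]), Complex.ofReal_zero]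

theorem tentTransform_add (B : ℝ) (f g : ArtinianAlgebra) :
    tentTransform B (f + g) = tentTransform B f + tentTransform B g := by
  refine UniformFun.toFun.injective (funext fun θ => ?_)
  rw [UniformFun.toFun_add, Pi.add_apply]
  simp only [tentTransform_apply, coeff_add, add_mul]
  exact finsum_add_distrib (tentTransform_support_finite f _) (tentTransform_support_finite g _)

theorem tentTransform_smul_apply (B : ℝ) (c : ℂ) (f : ArtinianAlgebra) (θ : Set.Iic B) :
    UniformFun.toFun (tentTransform B (c • f)) θ
      = c * UniformFun.toFun (tentTransform B f) θ := by
  simp only [tentTransform_apply, coeff_smul, mul_assoc]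
  exact (mul_finsum _ _).symm

theorem tentTransform_monomial (B a : ℝ) (c : ℂ) (θ : Set.Iic B) :
    UniformFun.toFun (tentTransform B (seriesMonomial a c)) θ
      = c * ((max 0 (θ.1 - a) : ℝ) : ℂ) := by
  rw [tentTransform_apply, finsum_eq_single _ a, coeff_seriesMonomial, if_pos rfl]
  intro a' ha'
  rw [coeff_seriesMonomial, if_neg ha', zero_mul]

theorem tentTransform_of_mem {B : ℝ} {f : ArtinianAlgebra} (hf : f ∈ seriesGE B) :
    tentTransform B f = 0 := by
  refine UniformFun.toFun.injective (funext fun θ => ?_)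
  rw [UniformFun.toFun_zero, Pi.zero_apply, tentTransform_apply]
  refine finsum_eq_zero_of_forall_eq_zero fun a => ?_
  by_cases ha : a < B
  · rw [hf a ha, zero_mul]
  · have := θ.2
    rw [Set.mem_Iic] at this
    rw [max_eq_left (by linarith), Complex.ofReal_zero, mul_zero]

theorem exists_tentTransform_ne_zero {B N : ℝ} (hN : N < B) {f : ArtinianAlgebra}
    (hf : ArtinianHasDegree f N) :
    ∃ θ, UniformFun.toFun (tentTransform B f) θ ≠ 0 := by
  obtain ⟨δ, hδ, hy⟩ := exists_unitPart_mem hf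
  have hf' := artinianHasDegree_iff.1 hf
  have hgap (a : ℝ) (ha : a ≠ N) (ha' : a < N + δ) : f.1.coeff a = 0 := by
    have h := hy (a - N) (by linarith)
    rw [coeff_unitPart, if_neg (sub_ne_zero.2 ha), sub_zero, sub_add_cancel,
      div_eq_zero_iff] at h
    exact h.resolve_right hf'.1
  -- Up to `N + δ` only the leading term is seen by the tent.
  refine ⟨⟨min B (N + δ), Set.mem_Iic.2 (min_le_left _ _)⟩, ?_⟩
  rw [tentTransform_apply, finsum_eq_single _ N]
  · have hpos : 0 < min B (N + δ) - N := sub_pos.2 (lt_min hN (by linarith))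
    refine mul_ne_zero hf'.1 ?_
    rw [max_eq_right hpos.le]
    exact_mod_cast hpos.ne'
  · intro a ha
    by_cases ha' : a < N + δ
    · rw [hgap a ha ha', zero_mul]
    · have := min_le_right B (N + δ)
      rw [max_eq_left (by simp only; linarith), Complex.ofReal_zero, mul_zero]

section

attribute [local instance] artinianTopology isTopologicalAddGroup_artinian continuousAdd_artinian

/-- Single coefficients are not continuous, since `x^{a_k} → x^a` moves exponents. The tent is
1-Lipschitz in the exponent, so averaging against it is continuous, uniformly for `θ ≤ B`. -/
theorem continuous_tentTransform (B : ℝ) : Continuous (tentTransform B) := by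
  refine continuous_of_seriesTopology _ (tentTransform_add B) (fun a c α γ ha hc => ?_)
    fun s hs => ?_
  · rw [UniformFun.tendsto_iff_tendstoUniformly, Metric.tendstoUniformly_iff]
    intro ε hε
    have hlim : Tendsto (fun k => ‖c k - γ‖ * max 0 (B - a k) + ‖γ‖ * |a k - α|) atTop (𝓝 0) := by
      have h1 : Tendsto (fun k => ‖c k - γ‖) atTop (𝓝 0) := by
        simpa using (hc.sub_const γ).norm
      have h2 : Tendsto (fun k => |a k - α|) atTop (𝓝 0) := by
        simpa using (ha.sub_const α).abs
      have h3 : Tendsto (fun k => max 0 (B - a k)) atTop (𝓝 (max 0 (B - α))) :=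
        tendsto_const_nhds.max (tendsto_const_nhds.sub ha)
      simpa using (h1.mul h3).add (h2.const_mul ‖γ‖)
    filter_upwards [hlim.eventually_lt_const hε] with k hk θ
    refine lt_of_le_of_lt ?_ hk
    simp only [Function.comp_apply, tentTransform_monomial]
    rw [dist_comm, dist_eq_norm, show c k * ((max 0 (θ.1 - a k) : ℝ) : ℂ)
        - γ * ((max 0 (θ.1 - α) : ℝ) : ℂ) = (c k - γ) * ((max 0 (θ.1 - a k) : ℝ) : ℂ)
        + γ * ((max 0 (θ.1 - a k) - max 0 (θ.1 - α) : ℝ) : ℂ) by push_cast; ring]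
    refine (norm_add_le _ _).trans ?_
    rw [norm_mul, norm_mul, Complex.norm_real, Complex.norm_real, Real.norm_eq_abs,
      Real.norm_eq_abs, abs_of_nonneg (le_max_left 0 (θ.1 - a k))]
    have hθ := θ.2
    rw [Set.mem_Iic] at hθ
    refine add_le_add (by gcongr) (mul_le_mul_of_nonneg_left ?_ (norm_nonneg γ))
    have h4 := abs_max_sub_max_le_abs (θ.1 - a k) (θ.1 - α) 0
    rw [max_comm, max_comm (θ.1 - α)] at h4
    refine h4.trans (le_of_eq ?_)
    rw [abs_sub_comm]
    congr 1
    ring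
  · refine tendsto_const_nhds.congr' ?_
    filter_upwards [hs B] with k hk
    exact (tentTransform_of_mem fun b hb => hk b hb.le).symm

theorem t2Space_artinian : T2Space ArtinianAlgebra := by
  refine ⟨fun u v huv => ?_⟩
  have hne : u - v ≠ 0 := fun h => huv (by
    have : u = u - v + v := by ring
    rw [this, h, zero_add])
  obtain ⟨N, hN, hN'⟩ := exists_isLeast_support hne
  obtain ⟨θ, hθ⟩ := exists_tentTransform_ne_zero (B := N + 1) (by linarith)
    (artinianHasDegree_iff.2 ⟨hN', hN⟩)
  refine separated_by_continuous (continuous_tentTransform (N + 1)) fun h => hθ ?_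
  have h1 := tentTransform_add (N + 1) (u - v) v
  rw [sub_add_cancel, h] at h1
  rw [right_eq_add.1 h1]
  rfl

attribute [local instance] t2Space_artinian

/-! ### Continuous automorphisms are substitutions -/

theorem powSeries_natCast {g : ArtinianAlgebra} {e : ℝ} (hg : ArtinianHasDegree g e) (k : ℕ)
    (n : ℤ) : powSeries g e k n = g ^ k := by
  induction k with
  | zero => rw [Nat.cast_zero, powSeries_zero hg, pow_zero]
  | succ k ih => rw [Nat.cast_succ, powSeries_add hg, ih, powSeries_one hg, pow_succ]

theorem powSeries_hasDegree {g : ArtinianAlgebra} {e : ℝ} (hg : ArtinianHasDegree g e) (t : ℝ)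
    (n : ℤ) : ArtinianHasDegree (powSeries g e t n) (e * t) := by
  refine artinianHasDegree_iff.2 ⟨?_, powSeries_mem_seriesGE hg t n⟩
  rw [coeff_powSeries_self hg]
  exact complexPow_ne_zero (artinianHasDegree_iff.1 hg).1 _ _

/-- If `e ≤ 0`, every `g ^ k` has degree below `1` and a nonzero tent transform at some `θ k ≤ 1`.
Scaling that value to `1` contradicts convergence; as `θ k` varies, uniform convergence is
essential. -/
theorem degree_pos_of_tendsto {g : ArtinianAlgebra} {e : ℝ} (hg : ArtinianHasDegree g e)
    (h : ∀ c : ℕ → ℂ, Tendsto (fun k => c k • g ^ k) atTop (𝓝 0)) : 0 < e := by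
  by_contra he
  have hk (k : ℕ) : ∃ θ, UniformFun.toFun (tentTransform 1 (g ^ k)) θ ≠ 0 := by
    have h1 := powSeries_hasDegree hg k 0
    rw [powSeries_natCast hg] at h1
    refine exists_tentTransform_ne_zero ?_ h1
    have := mul_nonpos_of_nonpos_of_nonneg (not_lt.1 he) (Nat.cast_nonneg (α := ℝ) k)
    linarith
  choose θ hθ using hk
  have h1 := ((continuous_tentTransform 1).tendsto 0).comp
    (h fun k => (UniformFun.toFun (tentTransform 1 (g ^ k)) (θ k))⁻¹)
  rw [UniformFun.tendsto_iff_tendstoUniformly, Metric.tendstoUniformly_iff] at h1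
  obtain ⟨k, hk⟩ := (h1 1 one_pos).exists
  have h2 := hk (θ k)
  simp only [Function.comp_apply, tentTransform_smul_apply] at h2
  rw [inv_mul_cancel₀ (hθ k), tentTransform_of_mem (Submodule.zero_mem _),
    UniformFun.toFun_zero, Pi.zero_apply, dist_zero_left, norm_one] at h2
  exact lt_irrefl _ h2

/-- The constants already contain a primitive `m`-th root of unity, and in a domain its powers
exhaust the solutions of `u ^ m = 1`. -/
theorem exists_root_of_unity {u : ArtinianAlgebra} {m : ℕ} (hm : m ≠ 0) (hu : u ^ m = 1) :
    ∃ z : ℂ, ‖z‖ = 1 ∧ u = z • 1 := by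
  have hζ := Complex.isPrimitiveRoot_exp m hm
  have hζ' := hζ.map_of_injective (f := (HahnSeries.C : ℂ →+* HahnSeries ℝ ℂ))
    HahnSeries.C_injective
  have : NeZero m := ⟨hm⟩
  have hu' : u.1 ^ m = 1 := by
    rw [← SubmonoidClass.coe_pow, hu]
    rfl
  obtain ⟨i, -, hi⟩ := hζ'.eq_pow_of_pow_eq_one hu'
  refine ⟨Complex.exp (2 * Real.pi * Complex.I / m) ^ i, ?_, ?_⟩
  · rw [norm_pow, Complex.norm_eq_one_of_pow_eq_one hζ.pow_eq_one hm, one_pow]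
  · apply Subtype.ext
    rw [← hi, ← map_pow]
    ext b
    rw [coeff_smul, HahnSeries.C_apply, HahnSeries.coeff_single, OneMemClass.coe_one,
      HahnSeries.coeff_one]
    simp

theorem exists_eq_smul_powSeries_ratCast {H : ℝ → ArtinianAlgebra} (H0 : H 0 = 1)
    (Hadd : ∀ a b, H (a + b) = H a * H b) {e : ℝ} (hg : ArtinianHasDegree (H 1) e) (q : ℚ) :
    ∃ z : ℂ, ‖z‖ = 1 ∧ H q = z • powSeries (H 1) e q 0 := by
  -- The quotient of the two one-parameter groups is trivial at integers, hence a root of unity at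
  -- rationals.
  set ψ : ℝ → ArtinianAlgebra := fun a => H a * powSeries (H 1) e (-a) 0 with hψ
  have ψ0 : ψ 0 = 1 := by
    rw [hψ]
    beta_reduce
    rw [H0, neg_zero, powSeries_zero hg, one_mul]
  have ψadd (a b : ℝ) : ψ (a + b) = ψ a * ψ b := by
    rw [hψ]
    beta_reduce
    rw [Hadd, neg_add, powSeries_add hg, mul_mul_mul_comm]
  have ψnsmul (k : ℕ) (a : ℝ) : ψ (k * a) = ψ a ^ k := by
    induction k with
    | zero => rw [Nat.cast_zero, zero_mul, ψ0, pow_zero]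
    | succ k ih => rw [Nat.cast_succ, add_mul, one_mul, ψadd, ih, pow_succ]
  have ψ1 : ψ 1 = 1 := by
    have h : powSeries (H 1) e 1 0 * powSeries (H 1) e (-1) 0 = 1 := by
      rw [← powSeries_add hg, add_neg_cancel, powSeries_zero hg]
    rwa [powSeries_one hg] at h
  have ψneg (a : ℝ) (ha : ψ a = 1) : ψ (-a) = 1 := by
    rw [← one_mul (ψ (-a)), ← ha, ← ψadd, add_neg_cancel, ψ0, ha]
  have ψint (p : ℤ) : ψ p = 1 := by
    have hnat (k : ℕ) : ψ k = 1 := by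
      have := ψnsmul k 1
      rwa [mul_one, ψ1, one_pow] at this
    obtain ⟨k, rfl | rfl⟩ := p.eq_nat_or_neg
    · exact_mod_cast hnat k
    · have := ψneg _ (hnat k)
      exact_mod_cast this
  have hroot : ψ q ^ q.den = 1 := by
    rw [← ψnsmul, ← ψint q.num]
    congr 1
    exact_mod_cast Rat.den_mul_eq_num q
  obtain ⟨z, hz, hz'⟩ := exists_root_of_unity q.den_ne_zero hroot
  refine ⟨z, hz, ?_⟩
  have h1 : ψ q * powSeries (H 1) e q 0 = H q := by
    rw [hψ]
    beta_reduce
    rw [mul_assoc, ← powSeries_add hg, neg_add_cancel, powSeries_zero hg, mul_one]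
  rw [← h1, hz', smul_mul_assoc, one_mul]

theorem exists_eq_powSeries_of_tendsto {H : ℝ → ArtinianAlgebra} (H0 : H 0 = 1)
    (Hadd : ∀ a b, H (a + b) = H a * H b)
    (Hlim : ∀ (a : ℕ → ℝ) (α : ℝ), Tendsto a atTop (𝓝 α) →
      Tendsto (fun k => H (a k)) atTop (𝓝 (H α))) :
    ∃ (e : ℝ) (n : ℤ), ArtinianHasDegree (H 1) e ∧ ∀ a, H a = powSeries (H 1) e a n := by
  have hne : H 1 ≠ 0 := by
    intro h
    have h1 := Hadd 1 (-1)
    rw [add_neg_cancel, H0, h, zero_mul] at h1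
    have h2 := congrArg (fun f : ArtinianAlgebra => f.1.coeff 0) h1
    simp at h2
  obtain ⟨e, he, he'⟩ := exists_isLeast_support hne
  have hg : ArtinianHasDegree (H 1) e := artinianHasDegree_iff.2 ⟨he', he⟩
  have hlimit (a : ℕ → ℝ) (α : ℝ) (z : ℕ → ℂ) (w : ℂ) (ha : Tendsto a atTop (𝓝 α))
      (hz : Tendsto z atTop (𝓝 w)) (h : ∀ k, H (a k) = z k • powSeries (H 1) e (a k) 0) :
      H α = w • powSeries (H 1) e α 0 := by
    refine tendsto_nhds_unique (Hlim a α ha) ?_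
    simp only [h]
    exact tendsto_smul_powSeries hg 0 ha hz
  have hex (a : ℝ) : ∃ z : ℂ, ‖z‖ = 1 ∧ H a = z • powSeries (H 1) e a 0 := by
    obtain ⟨x, hx, hxa⟩ := mem_closure_iff_seq_limit.1 (Rat.denseRange_cast (𝕜 := ℝ) a)
    choose q hq using hx
    choose z hz hz' using exists_eq_smul_powSeries_ratCast H0 Hadd hg
    -- Nothing is known yet about how the factors at rationals vary, but a subsequence converges on
    -- the circle, and uniqueness of limits does the rest.
    obtain ⟨w, hw, φ, hφ, hlim⟩ := (isCompact_sphere (0 : ℂ) 1).tendsto_subseq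
      (x := fun k => z (q k)) fun k => by simp [hz]
    refine ⟨w, by simpa using hw, ?_⟩
    refine hlimit (fun k => x (φ k)) a (fun k => z (q (φ k))) w (hxa.comp hφ.tendsto_atTop) hlim
      fun k => ?_
    rw [← hq, hz']
  choose χ hχ hχ' using hex
  have huniq {a : ℝ} {z w : ℂ}
      (h : z • powSeries (H 1) e a 0 = w • powSeries (H 1) e a 0) : z = w := by
    have h1 := congrArg (fun f : ArtinianAlgebra => f.1.coeff (e * a)) h
    simp only [coeff_smul, coeff_powSeries_self hg] at h1
    exact mul_right_cancel₀ (complexPow_ne_zero he' _ _) h1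
  have χ0 : χ 0 = 1 := huniq (a := 0) (by
    rw [← hχ', H0, powSeries_zero hg, one_smul])
  have χ1 : χ 1 = 1 := huniq (a := 1) (by
    rw [← hχ', powSeries_one hg, one_smul])
  have χadd (a b : ℝ) : χ (a + b) = χ a * χ b := huniq (a := a + b) (by
    rw [← hχ', Hadd, hχ' a, hχ' b, smul_mul_smul_comm, powSeries_add hg])
  have χcont : Continuous χ := by
    refine continuous_iff_continuousAt.2 fun α => ?_
    rw [ContinuousAt, tendsto_nhds_iff_seq_tendsto]
    intro a ha
    -- Each subsequence has a further one along which `χ` converges, and `huniq` forces the limit to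
    -- be `χ α`.
    refine tendsto_of_subseq_tendsto fun ns hns => ?_
    obtain ⟨w, hw, φ, hφ, hlim⟩ := (isCompact_sphere (0 : ℂ) 1).tendsto_subseq
      (x := fun k => χ (a (ns k))) fun k => by simp [hχ]
    refine ⟨φ, ?_⟩
    have h1 := hlimit (fun k => a (ns (φ k))) α (fun k => χ (a (ns (φ k)))) w
      (ha.comp (hns.comp hφ.tendsto_atTop)) hlim fun k => hχ' _
    have h2 : w = χ α := huniq (a := α) (by rw [← h1, hχ' α])
    rw [← h2]
    exact hlim
  obtain ⟨n, hn⟩ := exists_eq_exp_of_continuous_mul χcont χ1 χ0 χadd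
  refine ⟨e, n, hg, fun a => ?_⟩
  rw [hχ', hn, ← powSeries_eq_smul]

/-- Every continuous automorphism is a substitution, for an arbitrary sign of the degree. -/
theorem exists_eq_composition {ε : ℝ} (hε : ε * ε = 1)
    (σ : ArtinianAlgebra ≃ₐ[ℂ] ArtinianAlgebra) (hσ : Continuous σ) :
    ∃ (g : ArtinianAlgebra) (e : ℝ) (n : ℤ), ArtinianHasDegree g e ∧ 0 < ε * e ∧
      ∀ f b, (Function.support fun a =>
          artinianCoeff f a * powCoeff (artinianCoeff g) e (ε * a) n b).Finite ∧
        artinianCoeff (σ f) b =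
          ∑ᶠ a, artinianCoeff f a * powCoeff (artinianCoeff g) e (ε * a) n b := by
  -- With `ε = -1`, `x^{-1}` takes the role of the variable, so `H 1` is the series to be
  -- substituted for it.
  set H : ℝ → ArtinianAlgebra := fun a => σ (seriesMonomial (ε * a) 1) with hH
  obtain ⟨e, n, hg, hHe⟩ := exists_eq_powSeries_of_tendsto (H := H)
    (by simp only [hH, mul_zero, seriesMonomial_zero_one, map_one])
    (fun a b => by
      simp only [hH]
      rw [← map_mul, seriesMonomial_mul, mul_one, mul_add])
    (fun a α ha => (hσ.tendsto _).comp
      (tendsto_seriesMonomial (ha.const_mul ε) tendsto_const_nhds))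
  have hmono (a : ℝ) (c : ℂ) : σ (seriesMonomial a c) = c • powSeries (H 1) e (ε * a) n := by
    rw [← hHe, hH]
    beta_reduce
    rw [← mul_assoc, hε, one_mul, seriesMonomial_eq_smul, map_smul]
  have hpos : 0 < ε * e := by
    have h1 : ArtinianHasDegree (σ (seriesMonomial 1 1)) (ε * e) := by
      rw [hmono, one_smul, mul_one, mul_comm]
      exact powSeries_hasDegree hg ε n
    -- The degree test is applied to the image of `x`, whose powers are the images of `x^k`.
    refine degree_pos_of_tendsto h1 fun c => ?_
    have h2 : Tendsto (fun k : ℕ => seriesMonomial (k : ℝ) (c k)) atTop (𝓝 0) := by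
      refine tendsto_zero_of_mem_seriesGE fun N => ?_
      obtain ⟨K, hK⟩ := exists_nat_gt N
      filter_upwards [eventually_ge_atTop K] with k hk
      refine seriesGE_anti (hK.le.trans ?_) (seriesMonomial_mem_seriesGE _ _)
      exact_mod_cast hk
    have h3 := (hσ.tendsto 0).comp h2
    rw [map_zero] at h3
    refine h3.congr fun k => ?_
    rw [Function.comp_apply, seriesMonomial_eq_smul, map_smul, ← map_pow, seriesMonomial_pow,
      mul_one]
  obtain ⟨σ', hσ', hmono', hcoeff⟩ := exists_composition hg hpos n
  have heq (f : ArtinianAlgebra) : σ f = σ' f := by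
    have htrunc : Tendsto (fun k : ℕ => truncLE f k) atTop (𝓝 f) := by
      refine tendsto_of_approx fun N => ⟨fun _ => f, f, ?_, by simp, tendsto_const_nhds⟩
      obtain ⟨K, hK⟩ := exists_nat_gt N
      filter_upwards [eventually_ge_atTop K] with k hk
      refine seriesGE_anti (hK.le.trans (show (K : ℝ) ≤ k by exact_mod_cast hk)) ?_
      intro b hb
      rw [coeff_sub, coeff_truncLE, if_pos hb.le, sub_self]
    refine tendsto_nhds_unique ((hσ.tendsto f).comp htrunc) ?_
    refine ((hσ'.tendsto f).comp htrunc).congr fun k => ?_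
    simp only [Function.comp_apply, truncLE, map_sum, hmono, hmono']
  refine ⟨H 1, e, n, hg, hpos, fun f b => ?_⟩
  rw [heq]
  exact hcoeff f b

end

/-! ### Passage between the Artinian and the Noetherian algebra -/

section Reindex

variable {Γ Γ' : Type} [AddCommGroup Γ] [LinearOrder Γ] [IsOrderedAddMonoid Γ]
  [AddCommGroup Γ'] [LinearOrder Γ'] [IsOrderedAddMonoid Γ']

/-- The homomorphism of algebras of series that an isomorphism of exponent groups induces. -/
def reindexSeries (e : Γ ≃+o Γ') : seriesAlgebra Γ →ₐ[ℂ] seriesAlgebra Γ' :=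
  ((HahnSeries.embDomainAlgHom (R := ℂ) (A := ℂ) (e : Γ →+ Γ') e.injective
    fun _ _ => e.map_le_map_iff').comp (seriesAlgebra Γ).val).codRestrict (seriesAlgebra Γ') <| by
    intro f a
    refine ((f.2 (e.symm a)).image e).subset ?_
    rintro b ⟨hb, hne⟩
    obtain ⟨c, rfl⟩ := e.surjective b
    refine ⟨c, ⟨?_, fun h0 => hne ?_⟩, rfl⟩
    · rw [← map_le_map_iff e]
      simpa using hb
    · rw [← h0]
      exact HahnSeries.embDomain_coeff

theorem coeff_reindexSeries (e : Γ ≃+o Γ') (f : seriesAlgebra Γ) (a : Γ) :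
    (reindexSeries e f).1.coeff (e a) = f.1.coeff a :=
  HahnSeries.embDomain_coeff

theorem coeff_reindexSeries' (e : Γ ≃+o Γ') (f : seriesAlgebra Γ) (a : Γ') :
    (reindexSeries e f).1.coeff a = f.1.coeff (e.symm a) := by
  rw [← coeff_reindexSeries e, e.apply_symm_apply]

theorem reindexSeries_monomial (e : Γ ≃+o Γ') (a : Γ) (c : ℂ) :
    reindexSeries e (seriesMonomial a c) = seriesMonomial (e a) c :=
  Subtype.ext HahnSeries.embDomain_single

/-- The isomorphism of algebras of series that an isomorphism of exponent groups induces. -/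
def reindexSeriesEquiv (e : Γ ≃+o Γ') : seriesAlgebra Γ ≃ₐ[ℂ] seriesAlgebra Γ' :=
  AlgEquiv.ofAlgHom (reindexSeries e) (reindexSeries e.symm)
    (AlgHom.ext fun f => Subtype.ext (HahnSeries.ext (funext fun a => by
      simp [coeff_reindexSeries'])))
    (AlgHom.ext fun f => Subtype.ext (HahnSeries.ext (funext fun a => by
      simp [coeff_reindexSeries'])))

theorem continuous_reindexSeries [TopologicalSpace Γ] [TopologicalSpace Γ'] (e : Γ ≃+o Γ')
    (he : Continuous e) : Continuous[seriesTopology Γ, seriesTopology Γ'] (reindexSeries e) := by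
  let _ := seriesTopology Γ'
  have h := isSeriesTopology_seriesTopology Γ'
  have : IsTopologicalAddGroup (seriesAlgebra Γ') := h.group
  refine continuous_of_seriesTopology _ (map_add (reindexSeries e)) (fun a c α γ ha hc => ?_)
    fun s hs => ?_
  · simp only [reindexSeries_monomial]
    exact h.monomial _ _ _ _ ((he.tendsto α).comp ha) hc
  · refine h.tail _ fun N => ?_
    filter_upwards [hs (e.symm N)] with k hk a ha
    rw [coeff_reindexSeries']
    refine hk _ ?_
    rw [← map_le_map_iff e]
    simpa using ha

end Reindex

/-- The isomorphism `a ↦ -a` of the ordered groups of exponents. -/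
def negDualIso : ℝ ≃+o ℝᵒᵈ where
  toFun a := OrderDual.toDual (-a)
  invFun a := -OrderDual.ofDual a
  left_inv a := by simp
  right_inv a := by simp
  map_add' a b := by rw [neg_add]; rfl
  map_le_map_iff' := by simp

/-- The isomorphism `f(x) ↦ f(x⁻¹)`. -/
def invertVariable : ArtinianAlgebra ≃ₐ[ℂ] NoetherianAlgebra := reindexSeriesEquiv negDualIso

theorem noetherianCoeff_invertVariable (f : ArtinianAlgebra) (a : ℝ) :
    noetherianCoeff (invertVariable f) a = artinianCoeff f (-a) :=
  coeff_reindexSeries' negDualIso f (OrderDual.toDual a)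

theorem artinianCoeff_invertVariable_symm (f : NoetherianAlgebra) (a : ℝ) :
    artinianCoeff (invertVariable.symm f) a = noetherianCoeff f (-a) := by
  rw [← neg_neg a, ← noetherianCoeff_invertVariable, AlgEquiv.apply_symm_apply, neg_neg]

theorem continuous_invertVariable :
    Continuous[artinianTopology, noetherianTopology] invertVariable :=
  continuous_reindexSeries negDualIso continuous_neg

theorem continuous_invertVariable_symm :
    Continuous[noetherianTopology, artinianTopology] invertVariable.symm :=
  continuous_reindexSeries negDualIso.symm continuous_neg

section

attribute [local instance] artinianTopology noetherianTopology

theorem continuous_invertVariable_conj {σ : ArtinianAlgebra ≃ₐ[ℂ] ArtinianAlgebra}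
    (hσ : Continuous σ) : Continuous (invertVariable.symm.trans (σ.trans invertVariable)) :=
  continuous_invertVariable.comp (hσ.comp continuous_invertVariable_symm)

theorem continuous_invertVariable_symm_conj {σ : NoetherianAlgebra ≃ₐ[ℂ] NoetherianAlgebra}
    (hσ : Continuous σ) : Continuous (invertVariable.trans (σ.trans invertVariable.symm)) :=
  continuous_invertVariable_symm.comp (hσ.comp continuous_invertVariable)

end

theorem artinianHasDegree_invertVariable_symm {g : NoetherianAlgebra} {d : ℝ} :
    ArtinianHasDegree (invertVariable.symm g) (-d) ↔ NoetherianHasDegree g d := by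
  simp only [ArtinianHasDegree, NoetherianHasDegree, IsLeast, IsGreatest, mem_lowerBounds,
    mem_upperBounds, Set.mem_ofPred_eq, artinianCoeff_invertVariable_symm, neg_neg]
  refine and_congr Iff.rfl ⟨fun h a ha => ?_, fun h a ha => ?_⟩
  · have := h (-a) (by rwa [neg_neg])
    linarith
  · have := h (-a) ha
    linarith

theorem multinomialCoeff_map_neg (t : ℝ) (M : Multiset ℝ) :
    multinomialCoeff t (M.map Neg.neg) = multinomialCoeff t M := by
  rw [multinomialCoeff, multinomialCoeff, Multiset.card_map, Multiset.toFinset_map,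
    Finset.prod_image fun _ _ _ _ h => neg_injective h]
  simp only [Multiset.count_map_eq_count' _ M neg_injective]

theorem powTerm_map_neg (g : ℝ → ℂ) (d t : ℝ) (M : Multiset ℝ) :
    powTerm (fun a => g (-a)) (-d) t (M.map Neg.neg) = powTerm g d t M := by
  rw [powTerm, powTerm, multinomialCoeff_map_neg, Multiset.map_map]
  simp [add_comm]

theorem map_neg_mem_powIndex {d t b : ℝ} {M : Multiset ℝ} :
    M.map Neg.neg ∈ powIndex (-d) t (-b) ↔ M ∈ powIndex d t b := by
  rw [powIndex, powIndex, Set.mem_ofPred_eq, Set.mem_ofPred_eq, Multiset.sum_map_neg']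
  refine and_congr ?_ ⟨fun h => by linarith, fun h => by linarith⟩
  simp [Multiset.mem_map]

theorem multiset_map_neg_injective :
    Function.Injective (Multiset.map (Neg.neg : ℝ → ℝ)) :=
  Multiset.map_injective neg_injective

/-- Negation is a bijection between the index sets of multisets and preserves the summands. The
leading coefficient is unchanged, so the branch `n` is too. -/
theorem powCoeff_neg (g : ℝ → ℂ) (d t : ℝ) (n : ℤ) (b : ℝ) :
    powCoeff (fun a => g (-a)) (-d) t n (-b) = powCoeff g d t n b := by
  rw [powCoeff, powCoeff, neg_neg]
  congr 1
  refine (finsum_mem_eq_of_bijOn (Multiset.map Neg.neg) ⟨fun M hM => map_neg_mem_powIndex.2 hM,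
    multiset_map_neg_injective.injOn, fun M hM => ?_⟩
    fun M _ => (powTerm_map_neg g d t M).symm).symm
  have h : (M.map Neg.neg).map Neg.neg = M := by simp
  exact ⟨M.map Neg.neg, map_neg_mem_powIndex.1 (h.symm ▸ hM), h⟩

theorem powIndex_inter_support_finite_noetherian {g : NoetherianAlgebra} {d : ℝ}
    (hg : NoetherianHasDegree g d) (t b : ℝ) :
    (powIndex d t b ∩ Function.support (powTerm (noetherianCoeff g) d t)).Finite := by
  have h := powIndex_inter_support_finite (artinianHasDegree_invertVariable_symm.2 hg) t (-b)
  refine (h.preimage multiset_map_neg_injective.injOn).subset ?_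
  rintro M ⟨hM, hne⟩
  refine ⟨map_neg_mem_powIndex.2 hM, ?_⟩
  rw [Function.mem_support, funext (artinianCoeff_invertVariable_symm g), powTerm_map_neg]
  exact hne

theorem isComposition_noetherian {f g h : NoetherianAlgebra} {d : ℝ} {n : ℤ}
    (hg : NoetherianHasDegree g d)
    (H : ∀ b, (Function.support fun a => artinianCoeff (invertVariable.symm f) a *
        powCoeff (artinianCoeff (invertVariable.symm g)) (-d) (-1 * a) n b).Finite ∧
      artinianCoeff (invertVariable.symm h) b =
        ∑ᶠ a, artinianCoeff (invertVariable.symm f) a *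
          powCoeff (artinianCoeff (invertVariable.symm g)) (-d) (-1 * a) n b) :
    IsComposition (noetherianCoeff f) (noetherianCoeff g) d n (noetherianCoeff h) := by
  simp only [funext (artinianCoeff_invertVariable_symm _), neg_one_mul] at H
  refine ⟨powIndex_inter_support_finite_noetherian hg, fun b => ?_, fun b => ?_⟩
  · have h1 := (H (-b)).1
    simp only [powCoeff_neg] at h1
    refine (h1.preimage neg_injective.injOn).subset fun a ha => ?_
    simpa using ha
  · have h2 := (H (-b)).2
    simp only [powCoeff_neg, neg_neg] at h2
    -- Inverting the variable turns `f_a` into `f_{-a}`; negating the summation index restores the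
    -- power `g^{a;n}`.
    rw [h2, ← finsum_comp_equiv (Equiv.neg ℝ)]
    simp

theorem isComposition_artinian {f g h : ArtinianAlgebra} {d : ℝ} {n : ℤ}
    (hg : ArtinianHasDegree g d)
    (H : ∀ b, (Function.support fun a => artinianCoeff f a *
        powCoeff (artinianCoeff g) d (1 * a) n b).Finite ∧
      artinianCoeff h b =
        ∑ᶠ a, artinianCoeff f a * powCoeff (artinianCoeff g) d (1 * a) n b) :
    IsComposition (artinianCoeff f) (artinianCoeff g) d n (artinianCoeff h) := by
  simp only [one_mul] at H
  exact ⟨powIndex_inter_support_finite hg, fun b => (H b).1, fun b => (H b).2⟩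

end

/-! ### The characterization of composition -/

theorem mainTheorem1 :
    ((∀ (g : ArtinianAlgebra) (d : ℝ), ArtinianHasDegree g d → 0 < d → ∀ n : ℤ,
        ∃ σ : ArtinianAlgebra ≃ₐ[ℂ] ArtinianAlgebra,
          Continuous[artinianTopology, artinianTopology] σ ∧
          ∀ f : ArtinianAlgebra,
            IsComposition (artinianCoeff f) (artinianCoeff g) d n (artinianCoeff (σ f))) ∧
      (∀ σ : ArtinianAlgebra ≃ₐ[ℂ] ArtinianAlgebra,
        Continuous[artinianTopology, artinianTopology] σ →
          ∃ (g : ArtinianAlgebra) (d : ℝ) (n : ℤ), ArtinianHasDegree g d ∧ 0 < d ∧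
            ∀ f : ArtinianAlgebra,
              IsComposition (artinianCoeff f) (artinianCoeff g) d n (artinianCoeff (σ f)))) ∧
    ((∀ (g : NoetherianAlgebra) (d : ℝ), NoetherianHasDegree g d → 0 < d → ∀ n : ℤ,
        ∃ σ : NoetherianAlgebra ≃ₐ[ℂ] NoetherianAlgebra,
          Continuous[noetherianTopology, noetherianTopology] σ ∧
          ∀ f : NoetherianAlgebra,
            IsComposition (noetherianCoeff f) (noetherianCoeff g) d n (noetherianCoeff (σ f))) ∧
      (∀ σ : NoetherianAlgebra ≃ₐ[ℂ] NoetherianAlgebra,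
        Continuous[noetherianTopology, noetherianTopology] σ →
          ∃ (g : NoetherianAlgebra) (d : ℝ) (n : ℤ), NoetherianHasDegree g d ∧ 0 < d ∧
            ∀ f : NoetherianAlgebra,
              IsComposition (noetherianCoeff f) (noetherianCoeff g) d n
                (noetherianCoeff (σ f)))) := by
  refine ⟨⟨fun g d hg hd n => ?_, fun σ hσ => ?_⟩, fun g d hg hd n => ?_, fun σ hσ => ?_⟩
  · obtain ⟨σ, hσ, -, h⟩ := exists_composition hg (ε := 1) (by linarith) n
    exact ⟨σ, hσ, fun f => isComposition_artinian hg (h f)⟩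
  · obtain ⟨g, d, n, hg, hd, h⟩ := exists_eq_composition (ε := 1) (by norm_num) σ hσ
    exact ⟨g, d, n, hg, by linarith, fun f => isComposition_artinian hg (h f)⟩
  · obtain ⟨σ, hσ, -, h⟩ := exists_composition (ε := -1)
      (artinianHasDegree_invertVariable_symm.2 hg) (by linarith) n
    refine ⟨invertVariable.symm.trans (σ.trans invertVariable),
      continuous_invertVariable_conj hσ,
      fun f => isComposition_noetherian hg ?_⟩
    simp only [AlgEquiv.trans_apply, AlgEquiv.symm_apply_apply]
    exact h (invertVariable.symm f)
  · obtain ⟨g, e, n, hg, he, h⟩ := exists_eq_composition (ε := -1) (by norm_num)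
      (invertVariable.trans (σ.trans invertVariable.symm))
      (continuous_invertVariable_symm_conj hσ)
    have hg' : NoetherianHasDegree (invertVariable g) (-e) := by
      rw [← artinianHasDegree_invertVariable_symm, AlgEquiv.symm_apply_apply, neg_neg]
      exact hg
    refine ⟨invertVariable g, -e, n, hg', by linarith,
      fun f => isComposition_noetherian hg' fun b => ?_⟩
    have h1 := h (invertVariable.symm f) b
    simp only [AlgEquiv.trans_apply, AlgEquiv.apply_symm_apply] at h1
    rw [AlgEquiv.symm_apply_apply, neg_neg]
    exact h1
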